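/- Let $K$ be an algebraically closed field, $R=K[[x,y]]$, $L=\operatorname{Frac}(R)$. Let $c>0$, let $U\in R$ be a unit and let $p\in R$ be not divisible by $x$; put $r=\frac{p}{x^cU}\in L$ and $P(x,y,T)=p-T\,x^cU=\sum A_{ij}x^iy^j\in K[T][[x,y]]$ (a special pencil). A dicritical divisor of $r$ is an irreducible component $E$ of the exceptional divisor of a composition $\pi$ of blow-ups of closed points over $0\in\operatorname{Spec}R$ such that $\pi^*(r)|_E$ is not constant (neither an element of $K$ nor $\infty$). Toric-Newton process. For an edge (compact one-dimensional face) $\ell$ of the Newton polygon of a special pencil, contained in the line $ni+mj=\omega$ with $n,m>0$ coprime, write $$P_\ell=\sum_{ni+mj=\omega}A_{ij}x^iy^j=x^uy^v\,q_\ell(x^m,y^n),$$ with $q_\ell$ homogeneous of degree $d_\ell>0$ and prime to $s_1s_2$. The edge is dicritical if $(c,0)$ is a vertex of it. For all coprime positive $n,m$ fix positive integers $a,b$ with $bn-am=1$. One step of the process replaces the pencil as follows. (i) If $P_\ell$ is proportional to $(y-Ax^m)^e$ with $n=1$, $A\in K$, substitute $y=y'+Ax^m$. (ii) For any other non-dicritical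 edge $\ell$ and any root $\alpha\in K$ of $q_\ell(1,s)$, substitute $(x,y)=(x_1^ny_1^a,\,x_1^my_1^b)$, $y_1=y'+\alpha$, and divide the result by $x_1^{\omega}y_1^{w}$, where $w=\min\{ai+bj: A_{ij}\ne0\}$. The results are again special pencils, in the new coordinates $(x',y')$, which are elements of $L$ (with $x'=x$ in case (i) and $x'=x_1=x^by^{-a}$, $y_1=x^{-m}y^n$ in case (ii)). The divisor $E_\ell$ associated to a dicritical edge $\ell$ of a special pencil reached from $P$ is the curve $x_1=0$ of the monomial map $(x,y)=(x_1^ny_1^a,x_1^my_1^b)$, where $(x,y)$ now denotes the coordinates of that pencil. Then for each dicritical divisor $E$ of $r$: 1. $\pi^*(r)|_E$ is a polynomial: the function field of $E$ is $K(z)$ for some $z$ transcendental over $K$, and $\pi^*(r)|_E\in K[z]$. 2. $E=E_\ell$ for some dicritical edge $\ell$ of some special pencil reached by the toric-Newton process of $P$. 3. Whenever $E=E_\ell$ for a dicritical edge $\ell$ of a special pencil $P'=p'-T\,x^{c'}U'$ reached by the process, the restriction $z$ of $y_1$ to $E$ is transcendental over $K$ and generates the function field of $E$ over $K$, and $\pi^*(r)|_E=q_E(z)$,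 where $q_E\in K[s]$ is a polynomial of degree $d_\ell$ determined by $$q_\ell(1,s)=U'(0,0)\,\bigl(q_E(s)-T\bigr).$$ In particular, if $U'(0,0)=1$, then $q_E(z)=q_\ell(1,z)+T$. -/

import Mathlib

open Polynomial (aeval)

noncomputable section

namespace SpecialPencil

/-- The ring `R = K[[x, y]]`; the variable `x` is `X 0` and the variable `y` is `X 1`. -/
abbrev Ser (K : Type*) [Field K] := MvPowerSeries (Fin 2) K

/-- The field of fractions `L` of `K[[x, y]]`. -/
abbrev Mer (K : Type*) [Field K] := FractionRing (Ser K)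

/-- The exponent of the monomial `x ^ i * y ^ j`. -/
def expo (i j : ℕ) : Fin 2 →₀ ℕ := Finsupp.single 0 i + Finsupp.single 1 j

section

variable {K : Type*} [Field K]

/-- The substitution `f(x, y) ↦ f(g, h)`, for `g`, `h` without constant term. -/
def substPair (g h : Ser K) (f : Ser K) : Ser K :=
  MvPowerSeries.subst (![g, h] : Fin 2 → Ser K) f

/-- All substitutions used below are `substPair g h` for series `g`, `h` without constant term,
for which substitution is defined. -/
theorem hasSubst_pair (g h : Ser K) (hg : MvPowerSeries.constantCoeff g = 0)
    (hh : MvPowerSeries.constantCoeff h = 0) :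
    MvPowerSeries.HasSubst (![g, h] : Fin 2 → Ser K) :=
  MvPowerSeries.hasSubst_of_constantCoeff_zero (by
    intro s
    fin_cases s
    · exact hg
    · exact hh)

end

/-- A special pencil `P = p - T x ^ c U`: the exponent `c` is positive, `U` is a unit and
`x` does not divide `p`. -/
structure Pencil (K : Type*) [Field K] where
  p : Ser K
  c : ℕ
  U : Ser K
  c_pos : 0 < c
  isUnit_U : IsUnit U
  not_dvd : ¬ (MvPowerSeries.X 0 : Ser K) ∣ p

namespace Pencil

variable {K : Type*} [Field K] (P : Pencil K)

/-- The denominator `x ^ c * U`. -/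
def den : Ser K := MvPowerSeries.X 0 ^ P.c * P.U

/-- The meromorphic germ `r = p / (x ^ c * U)`. -/
def germ : Mer K := algebraMap (Ser K) (Mer K) P.p / algebraMap (Ser K) (Mer K) P.den

/-- `P(x, y, T) = p - T x ^ c U`, as a power series in `x`, `y` whose coefficients are polynomials
in the indeterminate `T`. -/
def series : MvPowerSeries (Fin 2) (Polynomial K) :=
  MvPowerSeries.map (Polynomial.C : K →+* Polynomial K) P.p
    - MvPowerSeries.C (Polynomial.X : Polynomial K)
      * MvPowerSeries.map (Polynomial.C : K →+* Polynomial K) P.den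

/-- The coefficient `A i j` of `x ^ i * y ^ j` in `P(x, y, T)`. -/
def A (i j : ℕ) : Polynomial K := MvPowerSeries.coeff (expo i j) P.series

end Pencil

/-- Numerical data of an edge `ℓ` of a Newton polygon: coprime weights `(n, m)`, the end points
`(u + m * d, v)` and `(u, v + n * d)`, and the degree `d = d_ℓ`.  The edge lies in the line
`n * i + m * j = ω`. -/
structure EdgeData where
  n : ℕ
  m : ℕ
  u : ℕ
  v : ℕ
  d : ℕ

/-- The weight `ω` of (the monomials on) the edge. -/
def EdgeData.ω (e : EdgeData) : ℕ := e.n * e.u + e.m * e.v + e.n * e.m * e.d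

/-- `e` is an edge (a one-dimensional compact face) of the Newton polygon of `P`: the support of
`P` lies in the half-plane `ω ≤ n * i + m * j`, the points of the support on the line
`n * i + m * j = ω` satisfy `u ≤ i` and `v ≤ j`, and the two distinct points
`(u + m * d, v)` and `(u, v + n * d)` of this line belong to the support. -/
structure IsEdge {K : Type*} [Field K] (P : Pencil K) (e : EdgeData) : Prop where
  n_pos : 0 < e.n
  m_pos : 0 < e.m
  d_pos : 0 < e.d
  coprime : Nat.Coprime e.n e.m
  right_mem : P.A (e.u + e.m * e.d) e.v ≠ 0
  left_mem : P.A e.u (e.v + e.n * e.d) ≠ 0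
  le_weight : ∀ i j, P.A i j ≠ 0 → e.ω ≤ e.n * i + e.m * j
  on_line : ∀ i j, P.A i j ≠ 0 → e.n * i + e.m * j = e.ω → e.u ≤ i ∧ e.v ≤ j

section

variable {K : Type*} [Field K]

/-- The polynomial `q_ℓ(1, s)` in `K[T][s]`, where `q_ℓ(s₁, s₂)` is the homogeneous polynomial of
degree `d` such that the part of `P` supported on the line of the edge is
`P_ℓ(x, y) = x ^ u * y ^ v * q_ℓ(x ^ m, y ^ n)`.  The coefficient of `s₁ ^ (d - k) * s₂ ^ k` in
`q_ℓ` is that of `x ^ (u + m * (d - k)) * y ^ (v + n * k)` in `P`. -/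
def edgePoly (P : Pencil K) (e : EdgeData) : Polynomial (Polynomial K) :=
  ∑ k ∈ Finset.range (e.d + 1),
    Polynomial.monomial k (P.A (e.u + e.m * (e.d - k)) (e.v + e.n * k))

/-- A dicritical edge: an edge with `(c, 0)` as a vertex. -/
def IsDicriticalEdge (P : Pencil K) (e : EdgeData) : Prop :=
  IsEdge P e ∧ e.u + e.m * e.d = P.c ∧ e.v = 0

/-- `P_ℓ` is proportional to `(y - a * x ^ m) ^ d` (so that `(n, m) = (1, m)`). -/
def IsPowerEdge (P : Pencil K) (e : EdgeData) (a : K) : Prop :=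
  e.n = 1 ∧ e.u = 0 ∧ e.v = 0 ∧ ∃ β : K,
    edgePoly P e =
      Polynomial.C (Polynomial.C β) * (Polynomial.X - Polynomial.C (Polynomial.C a)) ^ e.d

/-- `B n m = (a, b)` is a choice of positive integers with `b * n - a * m = 1`, for all coprime
positive `n`, `m`. -/
def IsBezoutChoice (B : ℕ → ℕ → ℕ × ℕ) : Prop :=
  ∀ n m : ℕ, 0 < n → 0 < m → Nat.Coprime n m →
    0 < (B n m).1 ∧ 0 < (B n m).2 ∧ (B n m).2 * n = (B n m).1 * m + 1

/-- The pull-back by the monomial map `(x, y) = (x₁ ^ n * y₁ ^ a, x₁ ^ m * y₁ ^ b)` followed by the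
translation `y₁ = y' + α`. -/
def toricNewton (n m a b : ℕ) (α : K) : Ser K → Ser K :=
  substPair
    (MvPowerSeries.X 0 ^ n * (MvPowerSeries.X 1 + MvPowerSeries.C α) ^ a)
    (MvPowerSeries.X 0 ^ m * (MvPowerSeries.X 1 + MvPowerSeries.C α) ^ b)

/-- The pull-back by the change of variables `y = y' + α * x ^ m`. -/
def translation (m : ℕ) (α : K) : Ser K → Ser K :=
  substPair (MvPowerSeries.X 0)
    (MvPowerSeries.X 1 + MvPowerSeries.C α * MvPowerSeries.X 0 ^ m)

end

/-- A stage of the toric-Newton process: the special pencil reached, the composite pull-back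
`K[[x, y]] → K[[x', y']]` to the coordinates `(x', y')` of the stage, and these
coordinates, seen as elements of the field `L`. -/
structure Stage (K : Type*) [Field K] where
  pencil : Pencil K
  pull : Ser K → Ser K
  x : Mer K
  y : Mer K

section

variable {K : Type*} [Field K]

/-- The process starts with the pencil itself, in the coordinates `x`, `y`. -/
def Stage.init (P : Pencil K) : Stage K where
  pencil := P
  pull := id
  x := algebraMap (Ser K) (Mer K) (MvPowerSeries.X 0)
  y := algebraMap (Ser K) (Mer K) (MvPowerSeries.X 1)

/-- `Q` is the strict transform of `P` by the toric-Newton transformation associated to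
`(ℓ, α)`, i.e. the pull-back of `P` divided by
`x₁ ^ ω * (y' + α) ^ w`, where `w` is the least power of `y₁` that occurs in the pull-back of `P`
by the monomial map. -/
def IsStrictTransform (B : ℕ → ℕ → ℕ × ℕ) (P : Pencil K) (e : EdgeData) (α : K)
    (Q : Pencil K) : Prop :=
  ∃ w : ℕ,
    IsLeast {w' | ∃ i j, P.A i j ≠ 0 ∧ w' = (B e.n e.m).1 * i + (B e.n e.m).2 * j} w ∧
    MvPowerSeries.X 0 ^ e.ω * (MvPowerSeries.X 1 + MvPowerSeries.C α) ^ w * Q.p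
      = toricNewton e.n e.m (B e.n e.m).1 (B e.n e.m).2 α P.p ∧
    MvPowerSeries.X 0 ^ e.ω * (MvPowerSeries.X 1 + MvPowerSeries.C α) ^ w * Q.den
      = toricNewton e.n e.m (B e.n e.m).1 (B e.n e.m).2 α P.den

/-- One step of the toric-Newton process.

`toric`: the toric-Newton transformation associated to a non-dicritical edge `ℓ`, whose `P_ℓ` is
not proportional to a power of `y - A * x ^ m`, and to a root `α` of `q_ℓ(1, s)`.  The new
coordinates are `x₁ = x ^ b * y ^ (-a)` and `y' = y₁ - α`, with `y₁ = x ^ (-m) * y ^ n`.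

`translate`: if `P_ℓ` is proportional to a power of `y - α * x ^ m`, the change of variables
`y = y' + α * x ^ m`. -/
inductive Step (B : ℕ → ℕ → ℕ × ℕ) : Stage K → Stage K → Prop
  | toric (S S' : Stage K) (e : EdgeData) (α : K)
      (he : IsEdge S.pencil e) (hd : ¬ IsDicriticalEdge S.pencil e)
      (hp : ∀ a : K, ¬ IsPowerEdge S.pencil e a)
      (hα : (edgePoly S.pencil e).eval (Polynomial.C α) = 0)
      (hQ : IsStrictTransform B S.pencil e α S'.pencil)
      (hpull : S'.pull = toricNewton e.n e.m (B e.n e.m).1 (B e.n e.m).2 α ∘ S.pull)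
      (hx : S'.x = S.x ^ (B e.n e.m).2 / S.y ^ (B e.n e.m).1)
      (hy : S'.y = S.y ^ e.n / S.x ^ e.m - algebraMap K (Mer K) α) : Step B S S'
  | translate (S S' : Stage K) (e : EdgeData) (α : K)
      (he : IsEdge S.pencil e) (hp : IsPowerEdge S.pencil e α)
      (hQp : S'.pencil.p = translation e.m α S.pencil.p)
      (hQd : S'.pencil.den = translation e.m α S.pencil.den)
      (hpull : S'.pull = translation e.m α ∘ S.pull)
      (hx : S'.x = S.x)
      (hy : S'.y = S.y - algebraMap K (Mer K) α * S.x ^ e.m) : Step B S S'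

/-- `S` occurs in the toric-Newton process of `P`. -/
def InProcess (B : ℕ → ℕ → ℕ × ℕ) (P : Pencil K) (S : Stage K) : Prop :=
  Relation.ReflTransGen (Step B) (Stage.init P) S

/-- The pull-backs `K[[x, y]] → K[[x', y']]` to the (completed) local rings of the closed points
lying over the origin in a composition of blow-ups of closed points.  Over an algebraically closed
field the closed points of the exceptional line of one blow-up are the points `y / x = t`, with
`(x, y) = (x', x' * (y' + t))`, and the point `x / y = 0`, with `(x, y) = (x' * y', y')`. -/
inductive IsBlowUpPull : (Ser K → Ser K) → Prop
  | origin : IsBlowUpPull id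
  | finite (σ : Ser K → Ser K) (t : K) (hσ : IsBlowUpPull σ) :
      IsBlowUpPull (substPair (MvPowerSeries.X 0)
        (MvPowerSeries.X 0 * (MvPowerSeries.X 1 + MvPowerSeries.C t)) ∘ σ)
  | infinite (σ : Ser K → Ser K) (hσ : IsBlowUpPull σ) :
      IsBlowUpPull (substPair (MvPowerSeries.X 0 * MvPowerSeries.X 1)
        (MvPowerSeries.X 1) ∘ σ)

/-- `E` is (the local ring, inside the field `L`, of the generic point of) a component of the
exceptional divisor of a composition of blow-ups of closed points over the origin: after some
blow-ups, `E` is the exceptional line of the blow-up of a closed point, so that the valuation of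
`E` is the order at this point. -/
def IsExceptional (E : ValuationSubring (Mer K)) : Prop :=
  ∃ σ : Ser K → Ser K, IsBlowUpPull σ ∧ ∀ f g : Ser K, g ≠ 0 →
    (algebraMap (Ser K) (Mer K) f / algebraMap (Ser K) (Mer K) g ∈ E ↔
      (σ g).order ≤ (σ f).order)

/-- `f` and `g` are regular at the generic point of `E` and have the same restriction to `E`, i.e.
the same class in the residue field of `E`, which is the function field of the curve `E`. -/
def EqOn (E : ValuationSubring (Mer K)) (f g : Mer K) : Prop :=
  f ∈ E ∧ g ∈ E ∧ E.valuation (f - g) < 1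

/-- `E` is a dicritical divisor of the pencil: an exceptional component on which the function
`r` restricts to a function which is neither the constant `∞` nor a constant `t` in `K`. -/
def IsDicritical (P : Pencil K) (E : ValuationSubring (Mer K)) : Prop :=
  IsExceptional E ∧ P.germ ∈ E ∧ ∀ t : K, ¬ EqOn E P.germ (algebraMap K (Mer K) t)

/-- The restriction of `z` to `E` is an affine coordinate of the rational curve `E`: it is
transcendental over `K` and generates the function field of `E` over `K`. -/
structure IsCoordinate (E : ValuationSubring (Mer K)) (z : Mer K) : Prop where
  mem : z ∈ E
  transcendental : ∀ f : Polynomial K, f ≠ 0 → ¬ EqOn E (aeval z f) 0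
  generates : ∀ h ∈ E, ∃ f g : Polynomial K, g ≠ 0 ∧ EqOn E (aeval z g * h) (aeval z f)

/-- `E` is the divisor `x₁ = 0` of the monomial map `(x, y) = (x₁ ^ n * y₁ ^ a, x₁ ^ m * y₁ ^ b)`
associated to the edge `e` at the stage `S`.  As `x ^ i * y ^ j` becomes
`x₁ ^ (n * i + m * j) * y₁ ^ (a * i + b * j)`, where different monomials have different images, the
order along `x₁ = 0` of the pull-back of a series is its order for the weights `(n, m)`. -/
def IsDivisorOfEdge (S : Stage K) (e : EdgeData) (E : ValuationSubring (Mer K)) : Prop :=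
  ∀ f g : Ser K, g ≠ 0 →
    (algebraMap (Ser K) (Mer K) f / algebraMap (Ser K) (Mer K) g ∈ E ↔
      (S.pull g).weightedOrder ![e.n, e.m] ≤ (S.pull f).weightedOrder ![e.n, e.m])

/-- The coordinate `y₁ = x ^ (-m) * y ^ n` of the monomial map associated to the edge `e` at the
stage `S`, as an element of the field `L`. -/
def edgeCoord (S : Stage K) (e : EdgeData) : Mer K := S.y ^ e.n / S.x ^ e.m

end

end SpecialPencil

end

/-! The divisor `E` is tested along one parametrization. Composing the pull-back of the blow-ups
with the generic line `(x, y) = (t, t s)` gives a homomorphism `θ : K[[x, y]] → K(s)[[t]]`, and `E`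
consists of the quotients `f / g` with `ord θ g ≤ ord θ f`. Hence the residue field of `E` embeds in
`K(s)`, and dicritical means that the residue of `r` exists and lies outside `K`.

At a stage of the process let `ψ` be the induced parametrization. It factors through a monomial map
`(A ^ n Z ^ a, A ^ m Z ^ b)`, where `n : m` is the ratio of the orders of `x` and `y` and `Z` is a
unit with residue `ζ` (`exists_isChart`). Let `N` be the `(n, m)`-weight of `p`, to be compared with
the weight `n c` of the denominator (`IsChart.exists_edge`). If `N < n c`, regularity of `r` makes
the leading form of `p` vanish at `ζ`. So `ζ` is algebraic, hence in `K`, and it is a root of the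
polynomial of a non-dicritical edge: the process has a step that follows the parametrization
(`IsCentered.exists_step`). If `N ≥ n c`, nonconstancy of the residue of `r` forces a second point
of the support on the line through `(c, 0)`, which gives a dicritical edge, and forces `ζ` to be
transcendental. Then no leading form cancels, `ord ψ` is a multiple of the `(n, m)`-weight, and `E`
is the divisor of that edge.

The descent stops (`IsCentered.exists_dicritical`): `c · ord x` drops at each toric step, while a
translation keeps it and raises `ord y`, which is less than `c · ord x` before each translation.

Conversely, on the divisor of a dicritical edge the generic monomial chart sends `y₁` to the
parameter `s`. The leading forms of `p` and of the denominator share a power of `s`, and their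
quotient is a polynomial because the denominator has only the monomial `(c, 0)` on the line
(`isCoordinate_and_eqOn`). -/

noncomputable section

namespace SpecialPencil

/-! ### Weights, leading forms and expansions under monomial maps -/

section
variable {K : Type*} [Field K]

theorem expo_zero_apply (i j : ℕ) : expo i j 0 = i := by simp [expo]

theorem expo_one_apply (i j : ℕ) : expo i j 1 = j := by simp [expo]

theorem eq_expo (d : Fin 2 →₀ ℕ) : d = expo (d 0) (d 1) := by
  ext s; fin_cases s
  · exact (expo_zero_apply _ _).symm
  · exact (expo_one_apply _ _).symm

theorem expo_injective {i j i' j' : ℕ} (h : expo i j = expo i' j') : i = i' ∧ j = j' := by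
  constructor
  · simpa [expo_zero_apply] using DFunLike.congr_fun h 0
  · simpa [expo_one_apply] using DFunLike.congr_fun h 1

/-- Two-variable power series are equal if all their coefficients are. -/
theorem ext_expo {R : Type*} [Semiring R] {f g : MvPowerSeries (Fin 2) R}
    (h : ∀ i j, MvPowerSeries.coeff (expo i j) f = MvPowerSeries.coeff (expo i j) g) : f = g := by
  ext d; rw [eq_expo d]; exact h _ _

theorem monomial_expo (i j : ℕ) :
    (MvPowerSeries.monomial (expo i j) (1 : K) : Ser K) =
      MvPowerSeries.X 0 ^ i * MvPowerSeries.X 1 ^ j := by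
  rw [MvPowerSeries.X_pow_eq, MvPowerSeries.X_pow_eq, MvPowerSeries.monomial_mul_monomial, expo,
    one_mul]

theorem coeff_X_mul_of_apply_eq_zero (s : Fin 2) (f : Ser K) (d : Fin 2 →₀ ℕ) (h : d s = 0) :
    MvPowerSeries.coeff d (MvPowerSeries.X s * f) = 0 :=
  MvPowerSeries.X_dvd_iff.1 (dvd_mul_right _ _) d h

theorem coeff_X_mul_single_add (s : Fin 2) (f : Ser K) (d : Fin 2 →₀ ℕ) :
    MvPowerSeries.coeff (Finsupp.single s 1 + d) (MvPowerSeries.X s * f)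
      = MvPowerSeries.coeff d f := by
  rw [MvPowerSeries.X, MvPowerSeries.coeff_add_monomial_mul, one_mul]

theorem single_zero_add_expo (i j : ℕ) : Finsupp.single 0 1 + expo i j = expo (i + 1) j := by
  simp [expo, Finsupp.single_add]; abel

theorem single_one_add_expo (i j : ℕ) : Finsupp.single 1 1 + expo i j = expo i (j + 1) := by
  simp [expo, Finsupp.single_add]; abel

/-- All monomials of `f` have weight at least `N`, where `x`, `y` have the weights `n`, `m`. -/
def WeightGE (n m N : ℕ) (f : Ser K) : Prop :=
  ∀ i j, n * i + m * j < N → MvPowerSeries.coeff (expo i j) f = 0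

theorem weight_expo (n m i j : ℕ) : Finsupp.weight ![n, m] (expo i j) = n * i + m * j := by
  simp [expo, Finsupp.weight_single, mul_comm]

theorem weightGE_iff {n m N : ℕ} {f : Ser K} :
    WeightGE n m N f ↔ (N : ℕ∞) ≤ f.weightedOrder ![n, m] := by
  constructor
  · intro h
    refine MvPowerSeries.nat_le_weightedOrder _ fun d hd => ?_
    rw [eq_expo d] at hd ⊢
    rw [weight_expo] at hd
    exact h _ _ hd
  · intro h i j hij
    refine MvPowerSeries.coeff_eq_zero_of_lt_weightedOrder ![n, m] (lt_of_lt_of_le ?_ h)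
    rw [weight_expo]
    exact_mod_cast hij

/-- The constant term vanishes because `N > 0`; `f₁` takes all monomials divisible by `x`, and `f₂`
the pure powers of `y`. Truncated subtraction is harmless, a bound `0` being no condition. -/
theorem exists_eq_X_mul_add_X_mul {n m N : ℕ} (hN : 0 < N) {f : Ser K} (hf : WeightGE n m N f) :
    ∃ f₁ f₂ : Ser K, f = MvPowerSeries.X 0 * f₁ + MvPowerSeries.X 1 * f₂ ∧
      WeightGE n m (N - n) f₁ ∧ WeightGE n m (N - m) f₂ := by
  let f₁ : Ser K := fun d => MvPowerSeries.coeff (expo (d 0 + 1) (d 1)) f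
  let f₂ : Ser K := fun d => if d 0 = 0 then MvPowerSeries.coeff (expo 0 (d 1 + 1)) f else 0
  have h₁ : ∀ i j, MvPowerSeries.coeff (expo i j) f₁ = MvPowerSeries.coeff (expo (i + 1) j) f := by
    intro i j
    change MvPowerSeries.coeff (expo (expo i j 0 + 1) (expo i j 1)) f = _
    rw [expo_zero_apply, expo_one_apply]
  have h₂ : ∀ i j, MvPowerSeries.coeff (expo i j) f₂ =
      if i = 0 then MvPowerSeries.coeff (expo 0 (j + 1)) f else 0 := by
    intro i j
    change (if expo i j 0 = 0 then MvPowerSeries.coeff (expo 0 (expo i j 1 + 1)) f else 0) = _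
    rw [expo_zero_apply, expo_one_apply]
  refine ⟨f₁, f₂, ext_expo fun i j => ?_, fun i j hij => ?_, fun i j hij => ?_⟩
  · rw [map_add]
    rcases i with _ | i
    · rw [coeff_X_mul_of_apply_eq_zero 0 _ _ (expo_zero_apply _ _), zero_add]
      rcases j with _ | j
      · rw [coeff_X_mul_of_apply_eq_zero 1 _ _ (expo_one_apply _ _)]
        exact hf 0 0 (by simpa using hN)
      · rw [← single_one_add_expo, coeff_X_mul_single_add, h₂, if_pos rfl, single_one_add_expo]
    · rw [← single_zero_add_expo, coeff_X_mul_single_add, h₁, single_zero_add_expo]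
      rcases j with _ | j
      · rw [coeff_X_mul_of_apply_eq_zero 1 _ _ (expo_one_apply _ _), add_zero]
      · rw [← single_one_add_expo, coeff_X_mul_single_add, h₂, if_neg (by omega), add_zero]
  · rw [h₁]
    refine hf _ _ ?_
    rw [mul_add]; omega
  · rw [h₂]
    split_ifs with h
    · subst h
      refine hf _ _ ?_
      rw [mul_add]; omega
    · rfl

/-- Peeling off one variable at a time lowers `N`, so finitely many peelings suffice. Thus no
continuity of `θ` is needed, only its values on the two variables. -/
theorem pow_dvd_of_weightGE {M : Type*} [CommRing M] (θ : Ser K →+* M) {n m : ℕ} (hn : 0 < n)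
    (hm : 0 < m) {A G H : M} (hx : θ (MvPowerSeries.X 0) = A ^ n * G)
    (hy : θ (MvPowerSeries.X 1) = A ^ m * H) (N : ℕ) (f : Ser K) (hf : WeightGE n m N f) :
    A ^ N ∣ θ f := by
  induction N using Nat.strong_induction_on generalizing f with
  | _ N ih =>
    rcases Nat.eq_zero_or_pos N with rfl | hN
    · simp
    obtain ⟨f₁, f₂, rfl, h₁, h₂⟩ := exists_eq_X_mul_add_X_mul hN hf
    obtain ⟨r₁, hr₁⟩ := ih _ (by omega) f₁ h₁
    obtain ⟨r₂, hr₂⟩ := ih _ (by omega) f₂ h₂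
    rw [map_add, map_mul, map_mul, hx, hy, hr₁, hr₂]
    refine dvd_add ?_ ?_
    · refine (pow_dvd_pow A (show N ≤ n + (N - n) by omega)).trans ⟨G * r₁, ?_⟩
      rw [pow_add]; ring
    · refine (pow_dvd_pow A (show N ≤ m + (N - m) by omega)).trans ⟨H * r₂, ?_⟩
      rw [pow_add]; ring

/-- The points of the line `n * i + m * j = N`. -/
def linePoints (n m N : ℕ) : Finset (ℕ × ℕ) :=
  (Finset.range (N + 1) ×ˢ Finset.range (N + 1)).filter fun q => n * q.1 + m * q.2 = N

theorem mem_linePoints {n m N : ℕ} (hn : 0 < n) (hm : 0 < m) {q : ℕ × ℕ} :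
    q ∈ linePoints n m N ↔ n * q.1 + m * q.2 = N := by
  simp only [linePoints, Finset.mem_filter, Finset.mem_product, Finset.mem_range,
    and_iff_right_iff_imp]
  intro h
  have h₁ : q.1 ≤ n * q.1 := Nat.le_mul_of_pos_left _ hn
  have h₂ : q.2 ≤ m * q.2 := Nat.le_mul_of_pos_left _ hm
  omega

/-- The polynomial `F` such that the part of `f` supported on the line `n * i + m * j = N` becomes
`x₁ ^ N * F(y₁)` under `(x, y) = (x₁ ^ n * y₁ ^ a, x₁ ^ m * y₁ ^ b)`. -/
def lineForm (n m a b N : ℕ) (f : Ser K) : Polynomial K :=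
  ∑ q ∈ linePoints n m N,
    Polynomial.monomial (a * q.1 + b * q.2) (MvPowerSeries.coeff (expo q.1 q.2) f)

/-- The part of `f` supported on the line `n * i + m * j = N`. -/
def linePart (n m N : ℕ) (f : Ser K) : Ser K :=
  ∑ q ∈ linePoints n m N,
    MvPowerSeries.coeff (expo q.1 q.2) f • (MvPowerSeries.X 0 ^ q.1 * MvPowerSeries.X 1 ^ q.2)

theorem coeff_linePart {n m N : ℕ} (hn : 0 < n) (hm : 0 < m) (f : Ser K) (i j : ℕ) :
    MvPowerSeries.coeff (expo i j) (linePart n m N f) =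
      if n * i + m * j = N then MvPowerSeries.coeff (expo i j) f else 0 := by
  classical
  have h : ∀ q : ℕ × ℕ, MvPowerSeries.coeff (expo i j) (MvPowerSeries.coeff (expo q.1 q.2) f •
      ((MvPowerSeries.X 0 ^ q.1 * MvPowerSeries.X 1 ^ q.2 : Ser K))) =
      if q = (i, j) then MvPowerSeries.coeff (expo i j) f else 0 := by
    rintro ⟨i', j'⟩
    rw [← monomial_expo, MvPowerSeries.coeff_smul, MvPowerSeries.coeff_monomial]
    by_cases hq : ((i', j') : ℕ × ℕ) = (i, j)
    · simp only [Prod.mk.injEq] at hq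
      simp [hq.1, hq.2]
    · rw [if_neg hq, if_neg, mul_zero]
      intro h
      obtain ⟨rfl, rfl⟩ := expo_injective h
      exact hq rfl
  rw [linePart, map_sum, Finset.sum_congr rfl fun q _ => h q, Finset.sum_ite_eq']
  simp only [mem_linePoints hn hm]

theorem weightGE_sub_linePart {n m N : ℕ} (hn : 0 < n) (hm : 0 < m) {f : Ser K}
    (hf : WeightGE n m N f) : WeightGE n m (N + 1) (f - linePart n m N f) := by
  intro i j hij
  rw [map_sub, coeff_linePart hn hm]
  split_ifs with h
  · exact sub_self _
  · rw [hf i j (by omega), sub_zero]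

/-- The expansion of the pull-back of a power series by a monomial map
`(x, y) = (A ^ n * Z ^ a, A ^ m * Z ^ b)`. -/
theorem exists_expansion {M : Type*} [CommRing M] [Algebra K M] (θ : Ser K →ₐ[K] M)
    {n m a b : ℕ} (hn : 0 < n) (hm : 0 < m) {A Z : M}
    (hx : θ (MvPowerSeries.X 0) = A ^ n * Z ^ a) (hy : θ (MvPowerSeries.X 1) = A ^ m * Z ^ b)
    {N : ℕ} {f : Ser K} (hf : WeightGE n m N f) :
    ∃ r : M, θ f = A ^ N * (aeval Z (lineForm n m a b N f) + A * r) := by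
  -- Off the line the weight is at least `N + 1`, so the remainder carries an additional factor `A`.
  obtain ⟨r, hr⟩ := pow_dvd_of_weightGE (θ : Ser K →+* M) hn hm hx hy _ _
    (weightGE_sub_linePart hn hm hf)
  refine ⟨r, ?_⟩
  have hsum : θ (linePart n m N f) = A ^ N * aeval Z (lineForm n m a b N f) := by
    rw [linePart, lineForm, map_sum, map_sum, Finset.mul_sum]
    refine Finset.sum_congr rfl fun q hq => ?_
    rw [mem_linePoints hn hm] at hq
    rw [map_smul, map_mul, map_pow, map_pow, hx, hy, Polynomial.aeval_monomial, ← hq,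
      Algebra.smul_def]
    ring
  have h : θ f = θ (linePart n m N f) + A ^ (N + 1) * r := by
    rw [← hr]; simp
  rw [h, hsum, pow_succ]; ring

/-- On the line `n * i + m * j = N`, the exponent `a * i + b * j` determines the point. -/
theorem eq_of_mem_line {n m a b N i j i' j' : ℕ} (hab : b * n = a * m + 1)
    (h : n * i + m * j = N) (h' : n * i' + m * j' = N)
    (he : a * i + b * j = a * i' + b * j') : i = i' ∧ j = j' := by
  zify at *
  constructor
  · linear_combination b * (h - h') - m * he - (i - i' : ℤ) * hab
  · linear_combination -a * (h - h') + n * he - (j - j' : ℤ) * hab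

/-- Unimodularity of the monomial map keeps distinct points of the line from sharing an exponent, so
nothing cancels in the sum. -/
theorem lineForm_coeff {n m a b N : ℕ} (hn : 0 < n) (hm : 0 < m) (hab : b * n = a * m + 1)
    (f : Ser K) {i j : ℕ} (hij : n * i + m * j = N) :
    (lineForm n m a b N f).coeff (a * i + b * j) = MvPowerSeries.coeff (expo i j) f := by
  rw [lineForm, Polynomial.finsetSum_coeff, Finset.sum_eq_single (i, j)]
  · simp
  · intro q hq hne
    rw [Polynomial.coeff_monomial, if_neg]
    intro h
    rw [mem_linePoints hn hm] at hq
    obtain ⟨h₁, h₂⟩ := eq_of_mem_line hab hq hij h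
    exact hne (Prod.ext h₁ h₂)
  · intro h
    exact absurd ((mem_linePoints hn hm).2 hij) h

theorem exists_weight {n m : ℕ} {f : Ser K} (hf : f ≠ 0) :
    ∃ N : ℕ, f.weightedOrder ![n, m] = N ∧ WeightGE n m N f ∧
      ∃ i j, n * i + m * j = N ∧ MvPowerSeries.coeff (expo i j) f ≠ 0 := by
  have h := (MvPowerSeries.ne_zero_iff_weightedOrder_finite ![n, m]).1 hf
  obtain ⟨d, hd, hw⟩ := MvPowerSeries.exists_coeff_ne_zero_and_weightedOrder ![n, m] h
  rw [eq_expo d, weight_expo] at hw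
  rw [eq_expo d] at hd
  exact ⟨_, hw.symm, weightGE_iff.2 hw.le, _, _, rfl, hd⟩

theorem lineForm_ne_zero {n m a b N : ℕ} (hn : 0 < n) (hm : 0 < m) (hab : b * n = a * m + 1)
    {f : Ser K} {i j : ℕ} (hij : n * i + m * j = N) (h : MvPowerSeries.coeff (expo i j) f ≠ 0) :
    lineForm n m a b N f ≠ 0 := by
  intro h0
  apply h
  rw [← lineForm_coeff hn hm hab f hij, h0, Polynomial.coeff_zero]

end

/-! ### Residues in the fraction field of a power series ring -/

section
variable {K : Type*} [Field K] {κ : Type*} [Field κ]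

/-- The extension to fields of fractions of an injective homomorphism. -/
def fracExt {B : Type*} [CommRing B] [NoZeroDivisors B] [Nontrivial B] (θ : Ser K →+* B)
    (hθ : Function.Injective θ) : Mer K →+* FractionRing B :=
  haveI : IsDomain B := NoZeroDivisors.to_isDomain B
  IsFractionRing.map hθ

theorem fracExt_algebraMap {B : Type*} [CommRing B] [NoZeroDivisors B] [Nontrivial B] (θ : Ser K →+* B)
    (hθ : Function.Injective θ) (f : Ser K) :
    fracExt θ hθ (algebraMap (Ser K) (Mer K) f) = algebraMap B (FractionRing B) (θ f) := by
  simp [fracExt, IsFractionRing.map]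

/-- `h` is regular at the centre of `Θ`, with the residue `ρ`. -/
def HasResidue (Θ : Mer K →+* FractionRing (PowerSeries κ)) (h : Mer K) (ρ : κ) : Prop :=
  ∃ q : PowerSeries κ, Θ h = algebraMap _ _ q ∧ PowerSeries.constantCoeff q = ρ

variable {Θ : Mer K →+* FractionRing (PowerSeries κ)} {f g h : Mer K} {ρ ρ' : κ}

theorem HasResidue.add (hf : HasResidue Θ f ρ) (hg : HasResidue Θ g ρ') :
    HasResidue Θ (f + g) (ρ + ρ') := by
  obtain ⟨q, hq, rfl⟩ := hf
  obtain ⟨q', hq', rfl⟩ := hg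
  exact ⟨q + q', by rw [map_add, map_add, hq, hq'], map_add _ _ _⟩

theorem HasResidue.mul (hf : HasResidue Θ f ρ) (hg : HasResidue Θ g ρ') :
    HasResidue Θ (f * g) (ρ * ρ') := by
  obtain ⟨q, hq, rfl⟩ := hf
  obtain ⟨q', hq', rfl⟩ := hg
  exact ⟨q * q', by rw [map_mul, map_mul, hq, hq'], map_mul _ _ _⟩

theorem HasResidue.sub (hf : HasResidue Θ f ρ) (hg : HasResidue Θ g ρ') :
    HasResidue Θ (f - g) (ρ - ρ') := by
  obtain ⟨q, hq, rfl⟩ := hf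
  obtain ⟨q', hq', rfl⟩ := hg
  exact ⟨q - q', by rw [map_sub, map_sub, hq, hq'], map_sub _ _ _⟩

theorem HasResidue.unique (hf : HasResidue Θ f ρ) (hf' : HasResidue Θ f ρ') : ρ = ρ' := by
  obtain ⟨q, hq, rfl⟩ := hf
  obtain ⟨q', hq', rfl⟩ := hf'
  rw [IsFractionRing.injective (PowerSeries κ) _ (hq.symm.trans hq')]

end

/-! ### Monomial charts and valuation rings realized by a parametrization -/

section
variable {K : Type*} [Field K] {κ : Type*} [Field κ] [Algebra K κ]

theorem constantCoeff_aeval (Z : PowerSeries κ) (F : Polynomial K) :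
    PowerSeries.constantCoeff (aeval Z F) = aeval (PowerSeries.constantCoeff Z) F := by
  rw [Polynomial.aeval_def, Polynomial.aeval_def, Polynomial.hom_eval₂]
  congr 1

/-- The homomorphism `θ` is `(x, y) = (A ^ n * Z ^ a, A ^ m * Z ^ b)`, where `A` has positive
order, `Z` is a unit and `b * n - a * m = 1`. -/
structure IsChart (θ : Ser K →ₐ[K] PowerSeries κ) (n m a b : ℕ) (A Z : PowerSeries κ) :
    Prop where
  n_pos : 0 < n
  m_pos : 0 < m
  bezout : b * n = a * m + 1
  map_x : θ (MvPowerSeries.X 0) = A ^ n * Z ^ a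
  map_y : θ (MvPowerSeries.X 1) = A ^ m * Z ^ b
  ne_zero : A ≠ 0
  constantCoeff_left : PowerSeries.constantCoeff A = 0
  constantCoeff_right : PowerSeries.constantCoeff Z ≠ 0

variable {θ : Ser K →ₐ[K] PowerSeries κ} {n m a b : ℕ} {A Z : PowerSeries κ}

theorem IsChart.expansion (hC : IsChart θ n m a b A Z) {N : ℕ} {f : Ser K}
    (hf : WeightGE n m N f) : ∃ q : PowerSeries κ, θ f = A ^ N * q ∧
      PowerSeries.constantCoeff q =
        aeval (PowerSeries.constantCoeff Z) (lineForm n m a b N f) := by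
  obtain ⟨r, hr⟩ := exists_expansion θ hC.n_pos hC.m_pos hC.map_x hC.map_y hf
  refine ⟨_, hr, ?_⟩
  rw [map_add, map_mul, hC.constantCoeff_left, zero_mul, add_zero, constantCoeff_aeval]

/-- If `Z` has a transcendental residue, then the order of the pull-back is proportional to the
weighted order. -/
theorem IsChart.order_eq (hC : IsChart θ n m a b A Z)
    (hZ : Transcendental K (PowerSeries.constantCoeff Z)) (f : Ser K) :
    (θ f).order = f.weightedOrder ![n, m] * A.order := by
  rcases eq_or_ne f 0 with rfl | hf
  · have h : A.order ≠ 0 := PowerSeries.order_ne_zero_iff_constCoeff_eq_zero.2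
      hC.constantCoeff_left
    rw [map_zero, PowerSeries.order_zero, MvPowerSeries.weightedOrder_zero, ENat.top_mul h]
  · obtain ⟨N, hN, hw, i, j, hij, hc⟩ := exists_weight (n := n) (m := m) hf
    obtain ⟨q, hq, hq0⟩ := hC.expansion hw
    have hq1 : q.order = 0 := by
      by_contra h
      rw [← ne_eq, PowerSeries.order_ne_zero_iff_constCoeff_eq_zero, hq0] at h
      -- A nonzero polynomial over `K` cannot vanish at a transcendental residue, so the cofactor of
      -- `A ^ N` is a unit.
      exact lineForm_ne_zero hC.n_pos hC.m_pos hC.bezout hij hc (transcendental_iff.1 hZ _ h)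
    rw [hq, PowerSeries.order_mul, PowerSeries.order_pow, hq1, add_zero, hN, nsmul_eq_mul]

theorem hasResidue_algebraMap (θ : Ser K →ₐ[K] PowerSeries κ)
    (hθ : Function.Injective (θ : Ser K →+* PowerSeries κ)) (t : K) :
    HasResidue (fracExt (θ : Ser K →+* PowerSeries κ) hθ) (algebraMap K (Mer K) t)
      (algebraMap K κ t) := by
  refine ⟨algebraMap K (PowerSeries κ) t, ?_, ?_⟩
  · rw [IsScalarTower.algebraMap_apply K (Ser K) (Mer K), fracExt_algebraMap]
    simp
  · rfl

theorem HasResidue.aeval {hθ : Function.Injective (θ : Ser K →+* PowerSeries κ)} {z : Mer K}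
    {ζ : κ} (hz : HasResidue (fracExt (θ : Ser K →+* PowerSeries κ) hθ) z ζ)
    (F : Polynomial K) :
    HasResidue (fracExt (θ : Ser K →+* PowerSeries κ) hθ) (aeval z F) (aeval ζ F) := by
  induction F using Polynomial.induction_on' with
  | add p q hp hq => rw [map_add, map_add]; exact hp.add hq
  | monomial k c =>
    rw [Polynomial.aeval_monomial, Polynomial.aeval_monomial]
    refine (hasResidue_algebraMap θ hθ c).mul ?_
    induction k with
    | zero => rw [pow_zero, pow_zero]; exact ⟨1, by simp, by simp⟩
    | succ k ih => rw [pow_succ, pow_succ]; exact ih.mul hz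

/-- The valuation ring `E` is given by the order of the pull-back by `θ`. -/
def Realizes (E : ValuationSubring (Mer K)) (θ : Ser K →ₐ[K] PowerSeries κ) : Prop :=
  ∀ f g : Ser K, g ≠ 0 →
    (algebraMap (Ser K) (Mer K) f / algebraMap (Ser K) (Mer K) g ∈ E ↔
      (θ g).order ≤ (θ f).order)

variable {E : ValuationSubring (Mer K)}

/-- As membership in `E` depends on the quotient only, no nonzero series is killed. -/
theorem Realizes.injective (hE : Realizes E θ) :
    Function.Injective (θ : Ser K →+* PowerSeries κ) := by
  rw [injective_iff_map_eq_zero]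
  intro g hg
  by_contra hne
  change θ g = 0 at hg
  -- The element `1 / g` is written in two ways. If `θ g = 0`, the criterion for `g / g²` reads `⊤ ≤
  -- ⊤`, that for `1 / g` reads `⊤ ≤ 0`.
  have h₁ := hE (1 * g) (g * g) (mul_ne_zero hne hne)
  have h₂ := hE 1 g hne
  have hne' : algebraMap (Ser K) (Mer K) g ≠ 0 := by simpa using hne
  rw [map_mul, map_mul, mul_div_mul_right _ _ hne', h₂] at h₁
  simp [hg] at h₁

theorem order_le_order_iff_dvd (f g : PowerSeries κ) : g.order ≤ f.order ↔ g ∣ f := by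
  constructor
  · intro h
    rcases eq_or_ne g 0 with rfl | hg
    · rw [PowerSeries.order_zero, top_le_iff, PowerSeries.order_eq_top] at h
      rw [h]
    · have hu := (PowerSeries.Unit_of_divided_by_X_pow_order g).isUnit
      rw [PowerSeries.Unit_of_divided_by_X_pow_order_nonzero hg] at hu
      have h' : PowerSeries.X ^ g.order.toNat ∣ f := by
        refine PowerSeries.X_pow_dvd_iff.2 fun i hi => PowerSeries.coeff_of_lt_order _ ?_
        refine lt_of_lt_of_le ?_ h
        rw [← ENat.natCast_toNat (fun h => hg (PowerSeries.order_eq_top.1 h))]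
        exact_mod_cast hi
      rw [← PowerSeries.X_pow_order_mul_divXPowOrder (f := g)]
      exact (hu.mul_right_dvd).2 h'
  · rintro ⟨q, rfl⟩
    rw [PowerSeries.order_mul]
    exact le_self_add

/-- In the discrete valuation ring `κ[[t]]`, comparing orders is divisibility. So `E` is the
preimage of `κ[[t]]` under the extension of `θ` to fractions. -/
theorem Realizes.mem_iff (hE : Realizes E θ) (h : Mer K) :
    h ∈ E ↔ ∃ ρ, HasResidue (fracExt (θ : Ser K →+* PowerSeries κ) hE.injective) h ρ := by
  obtain ⟨f, g, hg, rfl⟩ := IsFractionRing.div_surjective (A := Ser K) h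
  have hg0 : g ≠ 0 := nonZeroDivisors.ne_zero hg
  have hθg : algebraMap _ (FractionRing (PowerSeries κ)) (θ g) ≠ 0 := by
    simpa using fun h => hg0 ((injective_iff_map_eq_zero _).1 hE.injective g h)
  rw [hE f g hg0, order_le_order_iff_dvd]
  simp only [HasResidue, map_div₀, fracExt_algebraMap, RingHom.coe_coe]
  constructor
  · rintro ⟨q, hq⟩
    exact ⟨_, q, by rw [hq, map_mul]; rw [mul_div_cancel_left₀ _ hθg], rfl⟩
  · rintro ⟨ρ, q, hq, -⟩
    refine ⟨q, IsFractionRing.injective _ (FractionRing (PowerSeries κ)) ?_⟩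
    rw [map_mul, ← hq, mul_div_cancel₀ _ hθg]

theorem Realizes.valuation_lt_one_iff (hE : Realizes E θ) (h : Mer K) :
    E.valuation h < 1 ↔
      HasResidue (fracExt (θ : Ser K →+* PowerSeries κ) hE.injective) h 0 := by
  rw [← ValuationSubring.mem_nonunits_iff]
  constructor
  · intro hh
    obtain ⟨q, hq, -⟩ : ∃ q : PowerSeries κ, _ ∧ _ :=
      ((hE.mem_iff h).1 (ValuationSubring.nonunits_subset hh)).choose_spec
    refine ⟨q, hq, ?_⟩
    by_contra hne
    rw [ValuationSubring.mem_nonunits_iff_or] at hh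
    rcases hh with rfl | hh
    · rw [map_zero, eq_comm, FaithfulSMul.algebraMap_eq_zero_iff] at hq
      exact hne (by rw [hq, map_zero])
    -- A nonzero constant term makes `q` invertible, which would put `h⁻¹` into `E`.
    · refine hh ((hE.mem_iff _).2 ⟨_, q⁻¹, ?_, rfl⟩)
      rw [map_inv₀, hq]
      refine inv_eq_of_mul_eq_one_right ?_
      rw [← map_mul, PowerSeries.mul_inv_cancel _ hne, map_one]
  · rintro ⟨q, hq, hq0⟩
    rw [ValuationSubring.mem_nonunits_iff_or, or_iff_not_imp_left]
    intro hne hmem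
    obtain ⟨ρ, q', hq', -⟩ := (hE.mem_iff _).1 hmem
    have h1 : q * q' = 1 := by
      apply IsFractionRing.injective _ (FractionRing (PowerSeries κ))
      rw [map_mul, ← hq, ← hq', ← map_mul, mul_inv_cancel₀ hne, map_one, map_one]
    have := congrArg PowerSeries.constantCoeff h1
    rw [map_mul, hq0, zero_mul, map_one] at this
    exact zero_ne_one this

theorem Realizes.eqOn_iff (hE : Realizes E θ) (f g : Mer K) :
    EqOn E f g ↔ ∃ ρ, HasResidue (fracExt (θ : Ser K →+* PowerSeries κ) hE.injective) f ρ ∧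
      HasResidue (fracExt (θ : Ser K →+* PowerSeries κ) hE.injective) g ρ := by
  rw [EqOn, hE.mem_iff, hE.mem_iff, hE.valuation_lt_one_iff]
  constructor
  · rintro ⟨⟨ρ, hf⟩, ⟨ρ', hg⟩, h⟩
    refine ⟨ρ, hf, ?_⟩
    rwa [sub_eq_zero.1 ((hf.sub hg).unique h)]
  · rintro ⟨ρ, hf, hg⟩
    exact ⟨⟨ρ, hf⟩, ⟨ρ, hg⟩, by simpa using hf.sub hg⟩

/-- The residue field of `E` is a subfield of `κ`, so generation by `z` follows once every element
of `κ` is a quotient of polynomials in `ζ`. -/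
theorem Realizes.isCoordinate (hE : Realizes E θ) {z : Mer K} {ζ : κ}
    (hz : HasResidue (fracExt (θ : Ser K →+* PowerSeries κ) hE.injective) z ζ)
    (hζ : Transcendental K ζ)
    (hgen : ∀ ρ : κ, ∃ f g : Polynomial K, g ≠ 0 ∧ aeval ζ g * ρ = aeval ζ f) :
    IsCoordinate E z where
  mem := (hE.mem_iff z).2 ⟨ζ, hz⟩
  transcendental f hf h := by
    obtain ⟨ρ, h₁, ρ0, h₂, h₃⟩ := (hE.eqOn_iff _ _).1 h
    rw [map_zero, eq_comm, FaithfulSMul.algebraMap_eq_zero_iff] at h₂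
    rw [h₂, map_zero] at h₃
    rw [← h₃] at h₁
    exact hf (transcendental_iff.1 hζ f ((hz.aeval f).unique h₁))
  generates h hh := by
    obtain ⟨ρ, hρ⟩ := (hE.mem_iff h).1 hh
    obtain ⟨f, g, hg, hfg⟩ := hgen ρ
    refine ⟨f, g, hg, (hE.eqOn_iff _ _).2 ⟨aeval ζ f, ?_, hz.aeval f⟩⟩
    rw [← hfg]
    exact (hz.aeval g).mul hρ

end

/-! ### Substitution homomorphisms -/

section
variable {K : Type*} [Field K] {τ S : Type*} [CommRing S] [Algebra K S]

theorem hasSubst_cons {g h : MvPowerSeries τ S} (hg : MvPowerSeries.constantCoeff g = 0)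
    (hh : MvPowerSeries.constantCoeff h = 0) :
    MvPowerSeries.HasSubst (![g, h] : Fin 2 → MvPowerSeries τ S) :=
  MvPowerSeries.hasSubst_of_constantCoeff_zero (by
    intro s
    fin_cases s
    · exact hg
    · exact hh)

/-- The homomorphism `f(x, y) ↦ f(g, h)`. -/
def evalHom (g h : MvPowerSeries τ S) (hg : MvPowerSeries.constantCoeff g = 0)
    (hh : MvPowerSeries.constantCoeff h = 0) : Ser K →ₐ[K] MvPowerSeries τ S :=
  MvPowerSeries.substAlgHom (hasSubst_cons hg hh)

section
variable {g h : MvPowerSeries τ S} (hg : MvPowerSeries.constantCoeff g = 0)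
    (hh : MvPowerSeries.constantCoeff h = 0)

theorem evalHom_apply (f : Ser K) :
    evalHom g h hg hh f = MvPowerSeries.subst ![g, h] f := by
  rw [evalHom, MvPowerSeries.substAlgHom_apply]

theorem evalHom_X_zero : evalHom g h hg hh (MvPowerSeries.X 0 : Ser K) = g := by
  rw [evalHom, MvPowerSeries.substAlgHom_X]; rfl

theorem evalHom_X_one : evalHom g h hg hh (MvPowerSeries.X 1 : Ser K) = h := by
  rw [evalHom, MvPowerSeries.substAlgHom_X]; rfl

theorem algHom_C {M : Type*} [CommRing M] [Algebra K M] (θ : Ser K →ₐ[K] M) (α : K) :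
    θ (MvPowerSeries.C α) = algebraMap K M α :=
  θ.commutes α

end

theorem substPair_eq_evalHom {g h : Ser K} (hg : MvPowerSeries.constantCoeff g = 0)
    (hh : MvPowerSeries.constantCoeff h = 0) : substPair g h = evalHom g h hg hh := by
  funext f
  rw [evalHom_apply]; rfl

theorem evalHom_evalHom {g h : MvPowerSeries τ S} (hg : MvPowerSeries.constantCoeff g = 0)
    (hh : MvPowerSeries.constantCoeff h = 0) {u v : Ser K}
    (hu : MvPowerSeries.constantCoeff u = 0) (hv : MvPowerSeries.constantCoeff v = 0)
    {g' h' : MvPowerSeries τ S} (hg' : MvPowerSeries.constantCoeff g' = 0)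
    (hh' : MvPowerSeries.constantCoeff h' = 0)
    (h₁ : evalHom g h hg hh u = g') (h₂ : evalHom g h hg hh v = h') (f : Ser K) :
    evalHom g h hg hh (evalHom u v hu hv f) = evalHom g' h' hg' hh' f := by
  rw [evalHom_apply, evalHom_apply, evalHom_apply,
    MvPowerSeries.subst_comp_subst_apply (hasSubst_cons hu hv) (hasSubst_cons hg hh)]
  congr 1
  funext s
  rw [← evalHom_apply hg hh]
  fin_cases s
  · exact h₁
  · exact h₂

theorem evalHom_X_X (f : Ser K) :
    evalHom (MvPowerSeries.X 0) (MvPowerSeries.X 1) (MvPowerSeries.constantCoeff_X _)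
      (MvPowerSeries.constantCoeff_X _) f = f := by
  have h : (![MvPowerSeries.X 0, MvPowerSeries.X 1] : Fin 2 → Ser K) = MvPowerSeries.X := by
    funext s; fin_cases s <;> rfl
  rw [evalHom_apply, h, MvPowerSeries.subst_self, id]

end

/-! ### The maps of the process and the pull-back to a stage -/

section
variable {K : Type*} [Field K]

theorem constantCoeff_X_pow_mul {n : ℕ} (hn : 0 < n) (f : Ser K) :
    MvPowerSeries.constantCoeff (MvPowerSeries.X 0 ^ n * f) = 0 := by
  simp [hn.ne']

theorem constantCoeff_translate {m : ℕ} (hm : 0 < m) (α : K) :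
    MvPowerSeries.constantCoeff
      (MvPowerSeries.X 1 + MvPowerSeries.C α * MvPowerSeries.X 0 ^ m : Ser K) = 0 := by
  simp [hm.ne']

/-- `toricNewton` as a homomorphism. -/
def toricHom {n m : ℕ} (hn : 0 < n) (hm : 0 < m) (a b : ℕ) (α : K) : Ser K →ₐ[K] Ser K :=
  evalHom _ _
    (constantCoeff_X_pow_mul hn ((MvPowerSeries.X 1 + MvPowerSeries.C α) ^ a))
    (constantCoeff_X_pow_mul hm ((MvPowerSeries.X 1 + MvPowerSeries.C α) ^ b))

theorem toricNewton_eq {n m : ℕ} (hn : 0 < n) (hm : 0 < m) (a b : ℕ) (α : K) :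
    toricNewton n m a b α = toricHom hn hm a b α :=
  substPair_eq_evalHom _ _

/-- `translation` as a homomorphism. -/
def translationHom {m : ℕ} (hm : 0 < m) (α : K) : Ser K →ₐ[K] Ser K :=
  evalHom _ _ (MvPowerSeries.constantCoeff_X 0) (constantCoeff_translate hm α)

theorem translation_eq {m : ℕ} (hm : 0 < m) (α : K) :
    translation m α = translationHom hm α :=
  substPair_eq_evalHom _ _

theorem translationHom_X_zero {m : ℕ} (hm : 0 < m) (α : K) :
    translationHom hm α (MvPowerSeries.X 0) = MvPowerSeries.X 0 :=
  evalHom_X_zero _ _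

theorem translationHom_X_one {m : ℕ} (hm : 0 < m) (α : K) :
    translationHom hm α (MvPowerSeries.X 1) =
      MvPowerSeries.X 1 + MvPowerSeries.C α * MvPowerSeries.X 0 ^ m :=
  evalHom_X_one _ _

theorem translationHom_neg {m : ℕ} (hm : 0 < m) (α : K) (f : Ser K) :
    translationHom hm (-α) (translationHom hm α f) = f := by
  conv_rhs => rw [← evalHom_X_X f]
  refine evalHom_evalHom _ _ _ _ _ _ ?_ ?_ f
  · rw [evalHom_X_zero]
  · rw [map_add, map_mul, map_pow, evalHom_X_zero, evalHom_X_one, algHom_C,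
      ← MvPowerSeries.c_eq_algebraMap, map_neg]
    ring

theorem translationHom_injective {m : ℕ} (hm : 0 < m) (α : K) :
    Function.Injective (translationHom hm α : Ser K →+* Ser K) :=
  Function.LeftInverse.injective (g := translationHom hm (-α)) (translationHom_neg hm α)

theorem isUnit_X_add_C {α : K} (hα : α ≠ 0) :
    IsUnit (MvPowerSeries.X 1 + MvPowerSeries.C α : Ser K) := by
  rw [MvPowerSeries.isUnit_iff_constantCoeff]
  simpa using hα

theorem X_ne_zero (s : Fin 2) : (MvPowerSeries.X s : Ser K) ≠ 0 := by
  intro h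
  have := congrArg (MvPowerSeries.coeff (Finsupp.single s 1)) h
  simp at this

/-- The series is the translate of `F` by `α`, a nonzero polynomial in the second variable alone,
whose coefficients are those at the exponents `(0, k)`. -/
theorem not_X_dvd_aeval (α : K) {F : Polynomial K} (hF : F ≠ 0) :
    ¬ (MvPowerSeries.X 0 : Ser K) ∣ aeval (MvPowerSeries.X 1 + MvPowerSeries.C α) F := by
  intro h
  have h' : (MvPowerSeries.X 0 : Ser K) ∣
      aeval (MvPowerSeries.X 1) (F.comp (Polynomial.X + Polynomial.C α)) := by
    rw [Polynomial.aeval_comp]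
    simpa [← MvPowerSeries.c_eq_algebraMap] using h
  apply hF
  have h0 : F.comp (Polynomial.X + Polynomial.C α) = 0 := by
    ext k
    have := MvPowerSeries.X_dvd_iff.1 h' (expo 0 k) (expo_zero_apply 0 k)
    rw [Polynomial.aeval_eq_sum_range, map_sum] at this
    rw [Polynomial.coeff_zero, ← this]
    have hc : ∀ i, MvPowerSeries.coeff (expo 0 k) ((F.comp (Polynomial.X + Polynomial.C α)).coeff i •
        (MvPowerSeries.X 1 : Ser K) ^ i) =
        if i = k then (F.comp (Polynomial.X + Polynomial.C α)).coeff k else 0 := by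
      intro i
      classical
      have hm := monomial_expo (K := K) 0 i
      rw [pow_zero, one_mul] at hm
      rw [MvPowerSeries.coeff_smul, ← hm, MvPowerSeries.coeff_monomial]
      by_cases hik : i = k
      · simp [hik]
      · rw [if_neg hik, if_neg, mul_zero]
        intro h
        exact hik (expo_injective h).2.symm
    rw [Finset.sum_congr rfl fun i _ => hc i, Finset.sum_ite_eq']
    split_ifs with hk
    · rfl
    · rw [Finset.mem_range, not_lt] at hk
      exact Polynomial.coeff_eq_zero_of_natDegree_lt hk
  by_contra hne
  rw [Polynomial.comp_eq_zero_iff] at h0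
  rcases h0 with h0 | ⟨-, h0⟩
  · exact hne h0
  · have := congrArg (fun p => Polynomial.coeff p 1) h0
    simp [Polynomial.coeff_C] at this

section toric
variable {n m a b : ℕ} (hn : 0 < n) (hm : 0 < m) (α : K)

theorem toricHom_X_zero : toricHom hn hm a b α (MvPowerSeries.X 0) =
    MvPowerSeries.X 0 ^ n * (MvPowerSeries.X 1 + MvPowerSeries.C α) ^ a :=
  evalHom_X_zero _ _

theorem toricHom_X_one : toricHom hn hm a b α (MvPowerSeries.X 1) =
    MvPowerSeries.X 0 ^ m * (MvPowerSeries.X 1 + MvPowerSeries.C α) ^ b :=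
  evalHom_X_one _ _

/-- The strict transform of a series which has a monomial of minimal weight. -/
theorem toricHom_eq {N : ℕ} {f : Ser K} (hab : b * n = a * m + 1) (hf : WeightGE n m N f) {i j : ℕ}
    (hij : n * i + m * j = N) (hc : MvPowerSeries.coeff (expo i j) f ≠ 0) :
    ∃ g : Ser K, toricHom hn hm a b α f = MvPowerSeries.X 0 ^ N * g ∧
      ¬ MvPowerSeries.X 0 ∣ g := by
  obtain ⟨r, hr⟩ := exists_expansion (toricHom hn hm a b α) hn hm (toricHom_X_zero hn hm α)
    (toricHom_X_one hn hm α) hf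
  refine ⟨_, hr, ?_⟩
  rw [dvd_add_left (dvd_mul_right _ _)]
  exact not_X_dvd_aeval α (lineForm_ne_zero hn hm hab hij hc)

theorem toricHom_injective (hab : b * n = a * m + 1) :
    Function.Injective (toricHom hn hm a b α : Ser K →+* Ser K) := by
  rw [injective_iff_map_eq_zero]
  intro f hf
  by_contra hne
  obtain ⟨N, -, hw, i, j, hij, hc⟩ := exists_weight (n := n) (m := m) hne
  obtain ⟨g, hg, hdvd⟩ := toricHom_eq hn hm α hab hw hij hc
  change toricHom hn hm a b α f = 0 at hf
  rw [hg, mul_eq_zero, or_iff_right (pow_ne_zero _ (X_ne_zero 0))] at hf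
  exact hdvd (hf ▸ dvd_zero _)

end toric

theorem fracExt_comp {B : Type*} [CommRing B] [NoZeroDivisors B] [Nontrivial B] {φ : Ser K →+* Ser K}
    {ψ : Ser K →+* B} {χ : Ser K →+* B} (hφ : Function.Injective φ) (hψ : Function.Injective ψ)
    (hχ : Function.Injective χ) (h : ∀ f, χ f = ψ (φ f)) (z w : Mer K)
    (hz : fracExt φ hφ z = w) : fracExt χ hχ z = fracExt ψ hψ w := by
  subst hz
  obtain ⟨f, g, -, rfl⟩ := IsFractionRing.div_surjective (A := Ser K) z
  rw [map_div₀, map_div₀, fracExt_algebraMap, fracExt_algebraMap, fracExt_algebraMap,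
    fracExt_algebraMap]
  erw [map_div₀, fracExt_algebraMap, fracExt_algebraMap]
  rw [h, h]

theorem fracExt_constant {B : Type*} [CommRing B] [NoZeroDivisors B] [Nontrivial B] [Algebra K B]
    (θ : Ser K →ₐ[K] B) (hθ : Function.Injective (θ : Ser K →+* B)) (t : K) :
    fracExt (θ : Ser K →+* B) hθ (algebraMap K (Mer K) t) = algebraMap B _ (algebraMap K B t) := by
  rw [IsScalarTower.algebraMap_apply K (Ser K) (Mer K), fracExt_algebraMap]
  simp

/-- The homomorphism `φ` is the composite pull-back to the stage `S` of the process of `P`. -/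
structure IsPull (P : Pencil K) (S : Stage K) (φ : Ser K →ₐ[K] Ser K) : Prop where
  pull_eq : S.pull = φ
  injective : Function.Injective (φ : Ser K →+* Ser K)
  map_x : fracExt (φ : Ser K →+* Ser K) injective S.x = algebraMap (Ser K) (Mer K) (MvPowerSeries.X 0)
  map_y : fracExt (φ : Ser K →+* Ser K) injective S.y = algebraMap (Ser K) (Mer K) (MvPowerSeries.X 1)
  map_germ : φ P.p * S.pencil.den = φ P.den * S.pencil.p

theorem IsPull.init (P : Pencil K) : IsPull P (Stage.init P) (AlgHom.id K (Ser K)) where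
  pull_eq := rfl
  injective := Function.injective_id
  map_x := fracExt_algebraMap _ _ _
  map_y := fracExt_algebraMap _ _ _
  map_germ := mul_comm _ _

variable {B : ℕ → ℕ → ℕ × ℕ} {P : Pencil K} {S S' : Stage K}

/-- The value at `0` is the coefficient at the right end of the edge. So roots used by the process
are nonzero, and `y' + α` is a unit. -/
theorem edgePoly_eval_zero_ne {Q : Pencil K} {e : EdgeData} (he : IsEdge Q e) :
    (edgePoly Q e).eval (Polynomial.C (0 : K)) ≠ 0 := by
  rw [map_zero, ← Polynomial.coeff_zero_eq_eval_zero, edgePoly, Polynomial.finsetSum_coeff,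
    Finset.sum_eq_single 0]
  · simpa using he.right_mem
  · intro k _ hk
    rw [Polynomial.coeff_monomial, if_neg hk]
  · simp

/-- The relation `b n - a m = 1` inverts the monomial map, which identifies the new coordinates
inside `L`. The germ is preserved since numerator and denominator are divided by the same factor. -/
theorem IsPull.step (hB : IsBezoutChoice B) {φ : Ser K →ₐ[K] Ser K} (h : IsPull P S φ)
    (hs : Step B S S') : ∃ ψ, IsPull P S' ψ := by
  cases hs with
  | toric e α he hd hp hα hQ hpull hx hy =>
    obtain ⟨-, -, hab⟩ := hB _ _ he.n_pos he.m_pos he.coprime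
    have hα0 : α ≠ 0 := by
      rintro rfl
      exact edgePoly_eval_zero_ne he hα
    set a := (B e.n e.m).1
    set b := (B e.n e.m).2
    let T := toricHom he.n_pos he.m_pos a b α
    have hT : Function.Injective (T : Ser K →+* Ser K) :=
      toricHom_injective he.n_pos he.m_pos α hab
    have hinj : Function.Injective ((T.comp φ : Ser K →ₐ[K] Ser K) : Ser K →+* Ser K) :=
      hT.comp h.injective
    have key : ∀ z w, fracExt _ h.injective z = w →
        fracExt ((T.comp φ : Ser K →ₐ[K] Ser K) : Ser K →+* Ser K) hinj z = fracExt _ hT w :=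
      fracExt_comp h.injective hT hinj fun _ => rfl
    have kx := key _ _ h.map_x
    have ky := key _ _ h.map_y
    rw [fracExt_algebraMap] at kx ky
    have hTx : (T : Ser K →+* Ser K) (MvPowerSeries.X 0) =
        MvPowerSeries.X 0 ^ e.n * (MvPowerSeries.X 1 + MvPowerSeries.C α) ^ a :=
      toricHom_X_zero he.n_pos he.m_pos α
    have hTy : (T : Ser K →+* Ser K) (MvPowerSeries.X 1) =
        MvPowerSeries.X 0 ^ e.m * (MvPowerSeries.X 1 + MvPowerSeries.C α) ^ b :=
      toricHom_X_one he.n_pos he.m_pos α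
    have hX0 : algebraMap (Ser K) (Mer K) (MvPowerSeries.X 0) ≠ 0 := by
      simpa using X_ne_zero 0
    have hY0 : algebraMap (Ser K) (Mer K) (MvPowerSeries.X 1 + MvPowerSeries.C α) ≠ 0 :=
      (FaithfulSMul.algebraMap_eq_zero_iff (Ser K) (Mer K)).not.2 (isUnit_X_add_C hα0).ne_zero
    refine ⟨T.comp φ, ?_, hinj, ?_, ?_, ?_⟩
    · rw [hpull, h.pull_eq, toricNewton_eq he.n_pos he.m_pos]; rfl
    · rw [hx, map_div₀, map_pow, map_pow, kx, ky, hTx, hTy]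
      simp only [map_mul, map_pow]
      rw [div_eq_iff (pow_ne_zero _ (mul_ne_zero (pow_ne_zero _ hX0) (pow_ne_zero _ hY0))),
        mul_pow, mul_pow, ← pow_mul, ← pow_mul, ← pow_mul, ← pow_mul, mul_comm e.n, hab, pow_succ,
        mul_comm e.m, mul_comm a b]
      ring
    · rw [hy, map_sub, map_div₀, map_pow, map_pow, kx, ky, hTx, hTy, fracExt_constant]
      rw [sub_eq_iff_eq_add, ← map_add, ← MvPowerSeries.c_eq_algebraMap]
      simp only [map_mul, map_pow]
      rw [div_eq_iff (pow_ne_zero _ (mul_ne_zero (pow_ne_zero _ hX0) (pow_ne_zero _ hY0))),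
        mul_pow, mul_pow, ← pow_mul, ← pow_mul, ← pow_mul, ← pow_mul, hab, pow_succ,
        mul_comm e.m]
      ring
    · obtain ⟨w, -, hQp, hQd⟩ := hQ
      rw [toricNewton_eq he.n_pos he.m_pos] at hQp hQd
      have hne : (MvPowerSeries.X 0 ^ e.ω * (MvPowerSeries.X 1 + MvPowerSeries.C α) ^ w : Ser K)
          ≠ 0 := mul_ne_zero (pow_ne_zero _ (X_ne_zero 0))
            (pow_ne_zero _ (isUnit_X_add_C hα0).ne_zero)
      apply mul_left_cancel₀ hne
      rw [mul_left_comm, hQd, mul_left_comm _ (T.comp φ P.den), hQp]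
      change T _ * T _ = T _ * T _
      rw [← map_mul, ← map_mul]
      exact congrArg T h.map_germ
  | translate e α he hp hQp hQd hpull hx hy =>
    let T := translationHom he.m_pos α
    have hT : Function.Injective (T : Ser K →+* Ser K) := translationHom_injective he.m_pos α
    have hinj : Function.Injective ((T.comp φ : Ser K →ₐ[K] Ser K) : Ser K →+* Ser K) :=
      hT.comp h.injective
    have key : ∀ z w, fracExt _ h.injective z = w →
        fracExt ((T.comp φ : Ser K →ₐ[K] Ser K) : Ser K →+* Ser K) hinj z = fracExt _ hT w :=
      fracExt_comp h.injective hT hinj fun _ => rfl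
    have kx := key _ _ h.map_x
    have ky := key _ _ h.map_y
    rw [fracExt_algebraMap] at kx ky
    have hTx : (T : Ser K →+* Ser K) (MvPowerSeries.X 0) = MvPowerSeries.X 0 :=
      translationHom_X_zero he.m_pos α
    have hTy : (T : Ser K →+* Ser K) (MvPowerSeries.X 1) =
        MvPowerSeries.X 1 + MvPowerSeries.C α * MvPowerSeries.X 0 ^ e.m :=
      translationHom_X_one he.m_pos α
    refine ⟨T.comp φ, ?_, hinj, ?_, ?_, ?_⟩
    · rw [hpull, h.pull_eq, translation_eq he.m_pos]; rfl
    · rw [hx, kx, hTx]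
    · rw [hy, map_sub, map_mul, map_pow, kx, ky, hTx, hTy, fracExt_constant,
        ← MvPowerSeries.c_eq_algebraMap]
      simp only [map_add, map_mul, map_pow]
      ring
    · rw [hQp, hQd, translation_eq he.m_pos]
      change T _ * T _ = T _ * T _
      rw [← map_mul, ← map_mul]
      exact congrArg T h.map_germ

theorem InProcess.exists_isPull (hB : IsBezoutChoice B) (h : InProcess B P S) :
    ∃ φ, IsPull P S φ := by
  induction h with
  | refl => exact ⟨_, IsPull.init P⟩
  | tail _ hs ih =>
    obtain ⟨φ, hφ⟩ := ih
    exact hφ.step hB hs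

end

/-! ### Support of a pencil and polynomials of its edges -/

section
variable {K : Type*} [Field K]

namespace Pencil

variable (P : Pencil K)

theorem A_eq (i j : ℕ) : P.A i j = Polynomial.C (MvPowerSeries.coeff (expo i j) P.p) -
    Polynomial.X * Polynomial.C (MvPowerSeries.coeff (expo i j) P.den) := by
  rw [A, series, map_sub, MvPowerSeries.coeff_C_mul, MvPowerSeries.coeff_map,
    MvPowerSeries.coeff_map]

/-- As `T` is an indeterminate there is no cancellation: the support is the union of those of `p`
and of the denominator. -/
theorem A_eq_zero_iff (i j : ℕ) : P.A i j = 0 ↔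
    MvPowerSeries.coeff (expo i j) P.p = 0 ∧ MvPowerSeries.coeff (expo i j) P.den = 0 := by
  constructor
  · intro h
    rw [A_eq] at h
    have h₀ := congrArg (fun q => Polynomial.coeff q 0) h
    have h₁ := congrArg (fun q => Polynomial.coeff q 1) h
    simp [Polynomial.coeff_C] at h₀ h₁
    exact ⟨h₀, h₁⟩
  · rintro ⟨h₁, h₂⟩
    rw [A_eq, h₁, h₂]; simp

theorem constantCoeff_U_ne_zero : MvPowerSeries.constantCoeff P.U ≠ 0 :=
  (MvPowerSeries.isUnit_iff_constantCoeff.1 P.isUnit_U).ne_zero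

theorem den_ne_zero : P.den ≠ 0 :=
  mul_ne_zero (pow_ne_zero _ (X_ne_zero 0)) P.isUnit_U.ne_zero

theorem coeff_den_of_lt {i : ℕ} (j : ℕ) (h : i < P.c) :
    MvPowerSeries.coeff (expo i j) P.den = 0 :=
  MvPowerSeries.X_pow_dvd_iff.1 (dvd_mul_right _ P.U) _ (by rwa [expo_zero_apply])

theorem coeff_den_self :
    MvPowerSeries.coeff (expo P.c 0) P.den = MvPowerSeries.constantCoeff P.U := by
  have h : expo P.c 0 = Finsupp.single 0 P.c + 0 := by simp [expo]
  rw [h, den, MvPowerSeries.X_pow_eq, MvPowerSeries.coeff_add_monomial_mul, one_mul]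
  simp

theorem A_self_ne_zero : P.A P.c 0 ≠ 0 := by
  intro h
  have := ((P.A_eq_zero_iff _ _).1 h).2
  rw [P.coeff_den_self] at this
  exact P.constantCoeff_U_ne_zero this

theorem weightGE_den {n m N : ℕ} (h : N ≤ n * P.c) : WeightGE n m N P.den := by
  intro i j hij
  refine P.coeff_den_of_lt j ?_
  have : n * i < n * P.c := by omega
  exact Nat.lt_of_mul_lt_mul_left this

theorem coeff_den_of_lt_weight {n m i j : ℕ} (h : n * i + m * j < n * P.c) :
    MvPowerSeries.coeff (expo i j) P.den = 0 :=
  P.weightGE_den (n := n) (m := m) le_rfl i j h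

theorem coeff_den_of_line {n m i j : ℕ} (hm : 0 < m) (h : n * i + m * j = n * P.c)
    (hne : j ≠ 0) : MvPowerSeries.coeff (expo i j) P.den = 0 := by
  refine P.coeff_den_of_lt j ?_
  have h' : 0 < m * j := Nat.mul_pos hm (Nat.pos_of_ne_zero hne)
  have : n * i < n * P.c := by omega
  exact Nat.lt_of_mul_lt_mul_left this

/-- Any other point of the line with `j > 0` has `i < c`, where the factor `x ^ c` leaves no
monomials. -/
theorem lineForm_den_self {n m a b : ℕ} (hn : 0 < n) (hm : 0 < m) :
    lineForm n m a b (n * P.c) P.den =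
      Polynomial.monomial (a * P.c) (MvPowerSeries.constantCoeff P.U) := by
  rw [lineForm, Finset.sum_eq_single (P.c, 0)]
  · simp only [mul_zero, add_zero, coeff_den_self]
  · rintro ⟨i, j⟩ hq hne
    rw [mem_linePoints hn hm] at hq
    simp only at hq ⊢
    rcases eq_or_ne j 0 with rfl | hj
    · have hi : i = P.c := Nat.eq_of_mul_eq_mul_left hn (by simpa using hq)
      exact (hne (by rw [hi])).elim
    · rw [P.coeff_den_of_line hm hq hj, Polynomial.monomial_zero_right]
  · intro h
    exact absurd ((mem_linePoints hn hm).2 (by simp)) h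

end Pencil

/-- The contribution of a series to the polynomial of an edge. -/
def edgePart (f : Ser K) (e : EdgeData) : Polynomial K :=
  ∑ k ∈ Finset.range (e.d + 1),
    Polynomial.monomial k (MvPowerSeries.coeff (expo (e.u + e.m * (e.d - k)) (e.v + e.n * k)) f)

theorem edgePoly_eq (P : Pencil K) (e : EdgeData) :
    edgePoly P e = (edgePart P.p e).map Polynomial.C -
      Polynomial.C Polynomial.X * (edgePart P.den e).map Polynomial.C := by
  rw [edgePoly, edgePart, edgePart, Polynomial.map_sum, Polynomial.map_sum, Finset.mul_sum,
    ← Finset.sum_sub_distrib]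
  refine Finset.sum_congr rfl fun k _ => ?_
  rw [P.A_eq, Polynomial.map_monomial, Polynomial.map_monomial, Polynomial.C_mul_monomial,
    map_sub]

theorem edgePart_coeff (f : Ser K) (e : EdgeData) {k : ℕ} (hk : k ≤ e.d) :
    (edgePart f e).coeff k =
      MvPowerSeries.coeff (expo (e.u + e.m * (e.d - k)) (e.v + e.n * k)) f := by
  rw [edgePart, Polynomial.finsetSum_coeff, Finset.sum_eq_single k]
  · simp
  · intro l _ hl
    rw [Polynomial.coeff_monomial, if_neg hl]
  · intro h
    exact absurd (Finset.mem_range.2 (Nat.lt_succ_of_le hk)) h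

theorem edgePart_natDegree_le (f : Ser K) (e : EdgeData) : (edgePart f e).natDegree ≤ e.d :=
  Polynomial.natDegree_sum_le_of_forall_le _ _ fun _ hk =>
    (Polynomial.natDegree_monomial_le _).trans (Nat.lt_succ_iff.1 (Finset.mem_range.1 hk))

/-- The points `(i, j)` of the line with `u ≤ i` and `v ≤ j`. -/
theorem EdgeData.exists_of_line (e : EdgeData) (hn : 0 < e.n) (hm : 0 < e.m)
    (hc : Nat.Coprime e.n e.m) {i j : ℕ} (h : e.n * i + e.m * j = e.ω) (hi : e.u ≤ i)
    (hj : e.v ≤ j) : ∃ k ≤ e.d, i = e.u + e.m * (e.d - k) ∧ j = e.v + e.n * k := by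
  obtain ⟨i, rfl⟩ := Nat.exists_eq_add_of_le hi
  obtain ⟨j, rfl⟩ := Nat.exists_eq_add_of_le hj
  have h' : e.n * i + e.m * j = e.n * (e.m * e.d) := by
    rw [EdgeData.ω] at h; linarith
  have hdvd : e.n ∣ e.m * j := (Nat.dvd_add_right (dvd_mul_right _ _)).1 (h' ▸ dvd_mul_right _ _)
  obtain ⟨k, rfl⟩ := hc.dvd_of_dvd_mul_left hdvd
  have h₂ : i + e.m * k = e.m * e.d := by
    refine Nat.eq_of_mul_eq_mul_left hn ?_
    rw [← h']; ring
  have hk : k ≤ e.d := Nat.le_of_mul_le_mul_left (by omega : e.m * k ≤ e.m * e.d) hm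
  refine ⟨k, hk, ?_, rfl⟩
  rw [Nat.mul_sub]
  omega

theorem EdgeData.line (e : EdgeData) {k : ℕ} (hk : k ≤ e.d) :
    e.n * (e.u + e.m * (e.d - k)) + e.m * (e.v + e.n * k) = e.ω := by
  obtain ⟨l, hl⟩ := Nat.exists_eq_add_of_le hk
  rw [EdgeData.ω, hl, Nat.add_sub_cancel_left]; ring

theorem lineForm_eq_edgePart {e : EdgeData} (hn : 0 < e.n) (hm : 0 < e.m)
    (hc : Nat.Coprime e.n e.m) {a b : ℕ} (hab : b * e.n = a * e.m + 1) {f : Ser K}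
    (hf : ∀ i j, MvPowerSeries.coeff (expo i j) f ≠ 0 → e.n * i + e.m * j = e.ω →
      e.u ≤ i ∧ e.v ≤ j) :
    lineForm e.n e.m a b e.ω f =
      Polynomial.X ^ (a * (e.u + e.m * e.d) + b * e.v) * edgePart f e := by
  rw [edgePart, Finset.mul_sum, lineForm]
  symm
  refine Finset.sum_bij_ne_zero
    (fun k _ _ => (e.u + e.m * (e.d - k), e.v + e.n * k)) ?_ ?_ ?_ ?_
  · intro k hk _
    exact (mem_linePoints hn hm).2 (e.line (Nat.lt_succ_iff.1 (Finset.mem_range.1 hk)))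
  · intro k _ _ l _ _ h
    simp only [Prod.mk.injEq, Nat.add_left_cancel_iff] at h
    exact Nat.eq_of_mul_eq_mul_left hn h.2
  · rintro ⟨i, j⟩ hq hne
    rw [mem_linePoints hn hm] at hq
    have hne' : MvPowerSeries.coeff (expo i j) f ≠ 0 := by
      rintro h; rw [h] at hne; simp at hne
    obtain ⟨hi, hj⟩ := hf i j hne' hq
    obtain ⟨k, hk, rfl, rfl⟩ := e.exists_of_line hn hm hc hq hi hj
    refine ⟨k, Finset.mem_range.2 (Nat.lt_succ_of_le hk), ?_, rfl⟩
    exact mul_ne_zero (pow_ne_zero _ Polynomial.X_ne_zero)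
      (by rwa [ne_eq, Polynomial.monomial_eq_zero_iff])
  · intro k hk _
    obtain ⟨l, hl⟩ := Nat.exists_eq_add_of_le (Nat.lt_succ_iff.1 (Finset.mem_range.1 hk))
    have hexp : a * (e.u + e.m * (e.d - k)) + b * (e.v + e.n * k) =
        k + (a * (e.u + e.m * e.d) + b * e.v) := by
      rw [hl, Nat.add_sub_cancel_left]
      zify at hab ⊢
      linear_combination (k : ℤ) * hab
    rw [Polynomial.X_pow_mul_monomial, hexp]

namespace IsEdge

variable {P : Pencil K} {e : EdgeData}

theorem weightGE_p (he : IsEdge P e) : WeightGE e.n e.m e.ω P.p := by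
  intro i j hij
  by_contra h
  have := he.le_weight i j fun h' => h ((P.A_eq_zero_iff i j).1 h').1
  omega

theorem ω_le (he : IsEdge P e) : e.ω ≤ e.n * P.c := by
  simpa using he.le_weight _ _ P.A_self_ne_zero

theorem weightGE_den (he : IsEdge P e) : WeightGE e.n e.m e.ω P.den :=
  P.weightGE_den he.ω_le

/-- The point `(c, 0)` is always in the support and has the least possible ordinate, so if it lies
on the line it is the right end of the edge. -/
theorem isDicriticalEdge_iff (he : IsEdge P e) : IsDicriticalEdge P e ↔ e.ω = e.n * P.c := by
  constructor
  · rintro ⟨-, h, hv⟩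
    rw [EdgeData.ω, ← h, hv]; ring
  · intro h
    obtain ⟨h₁, h₂⟩ := he.on_line P.c 0 P.A_self_ne_zero (by simp [h])
    have hv : e.v = 0 := by omega
    refine ⟨he, Nat.eq_of_mul_eq_mul_left he.n_pos ?_, hv⟩
    rw [← h, EdgeData.ω, hv]; ring

theorem lineForm_p (he : IsEdge P e) {a b : ℕ} (hab : b * e.n = a * e.m + 1) :
    lineForm e.n e.m a b e.ω P.p =
      Polynomial.X ^ (a * (e.u + e.m * e.d) + b * e.v) * edgePart P.p e :=
  lineForm_eq_edgePart he.n_pos he.m_pos he.coprime hab fun i j h =>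
    he.on_line i j fun h' => h ((P.A_eq_zero_iff i j).1 h').1

end IsEdge

theorem edgePart_den_of_lt {P : Pencil K} {e : EdgeData} (h : e.ω < e.n * P.c) :
    edgePart P.den e = 0 := by
  refine Finset.sum_eq_zero fun k hk => ?_
  rw [P.coeff_den_of_lt_weight (n := e.n) (m := e.m), Polynomial.monomial_zero_right]
  rwa [e.line (Nat.lt_succ_iff.1 (Finset.mem_range.1 hk))]

theorem IsDicriticalEdge.edgePart_den {P : Pencil K} {e : EdgeData} (h : IsDicriticalEdge P e) :
    edgePart P.den e = Polynomial.C (MvPowerSeries.constantCoeff P.U) := by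
  have hω := h.1.isDicriticalEdge_iff.1 h
  rw [edgePart, Finset.sum_eq_single 0]
  · rw [← P.coeff_den_self, Nat.sub_zero, h.2.1, h.2.2, mul_zero]; rfl
  · intro k hk hne
    rw [P.coeff_den_of_line h.1.m_pos, Polynomial.monomial_zero_right]
    · rw [← hω, e.line (Nat.lt_succ_iff.1 (Finset.mem_range.1 hk))]
    · have := Nat.mul_pos h.1.n_pos (Nat.pos_of_ne_zero hne)
      omega
  · simp

/-- The restriction of the germ to the divisor of a dicritical edge. -/
def restriction (P : Pencil K) (e : EdgeData) : Polynomial K :=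
  Polynomial.C (MvPowerSeries.constantCoeff P.U)⁻¹ * edgePart P.p e

theorem IsDicriticalEdge.edgePoly_eq {P : Pencil K} {e : EdgeData} (h : IsDicriticalEdge P e) :
    edgePoly P e = Polynomial.C (Polynomial.C (MvPowerSeries.constantCoeff P.U)) *
      ((restriction P e).map Polynomial.C - Polynomial.C Polynomial.X) := by
  have hU : Polynomial.C (Polynomial.C (MvPowerSeries.constantCoeff P.U)) *
      Polynomial.C (Polynomial.C (MvPowerSeries.constantCoeff P.U)⁻¹) = 1 := by
    rw [← map_mul, ← map_mul, mul_inv_cancel₀ P.constantCoeff_U_ne_zero, map_one, map_one]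
  rw [SpecialPencil.edgePoly_eq, h.edgePart_den, restriction, Polynomial.map_mul,
    Polynomial.map_C, Polynomial.map_C]
  linear_combination (-(edgePart P.p e).map Polynomial.C) * hU

/-- The left end of the edge has abscissa `u < c`, where the denominator vanishes; hence the top
coefficient comes from `p` and is nonzero. -/
theorem IsDicriticalEdge.natDegree_restriction {P : Pencil K} {e : EdgeData}
    (h : IsDicriticalEdge P e) : (restriction P e).natDegree = e.d := by
  rw [restriction, Polynomial.natDegree_C_mul (inv_ne_zero P.constantCoeff_U_ne_zero)]
  refine le_antisymm (edgePart_natDegree_le _ _) (Polynomial.le_natDegree_of_ne_zero ?_)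
  rw [edgePart_coeff _ _ le_rfl, Nat.sub_self, mul_zero, add_zero]
  intro h0
  refine h.1.left_mem ((P.A_eq_zero_iff _ _).2 ⟨h0, P.coeff_den_of_lt _ ?_⟩)
  have := Nat.mul_pos h.1.m_pos h.1.d_pos
  have := h.2.1
  omega

end

/-! ### The germ on the divisor of a dicritical edge -/

section
variable {K : Type*} [Field K] {κ : Type*} [Field κ] [Algebra K κ]
  {P : Pencil K} {S : Stage K} {φ : Ser K →ₐ[K] Ser K} {θ ψ : Ser K →ₐ[K] PowerSeries κ}

/-- The residue of the germ in terms of the pencil of a stage. -/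
theorem IsPull.hasResidue_germ_iff (h : IsPull P S φ) (hθ : Function.Injective (θ : Ser K →+* PowerSeries κ))
    (hψ : ∀ f, ψ (φ f) = θ f) (hden : ψ S.pencil.den ≠ 0) (ρ : κ) :
    HasResidue (fracExt (θ : Ser K →+* PowerSeries κ) hθ) P.germ ρ ↔
      ∃ q : PowerSeries κ, ψ S.pencil.p = q * ψ S.pencil.den ∧
        PowerSeries.constantCoeff q = ρ := by
  have hP : θ P.den ≠ 0 := fun h0 =>
    P.den_ne_zero ((injective_iff_map_eq_zero _).1 hθ _ h0)
  have hP' : algebraMap _ (FractionRing (PowerSeries κ)) (θ P.den) ≠ 0 :=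
    (FaithfulSMul.algebraMap_eq_zero_iff _ _).not.2 hP
  have hg := congrArg ψ h.map_germ
  rw [map_mul, map_mul, hψ, hψ] at hg
  refine exists_congr fun q => and_congr_left fun _ => ?_
  rw [Pencil.germ, map_div₀, fracExt_algebraMap, fracExt_algebraMap]
  change algebraMap _ _ (θ P.p) / algebraMap _ _ (θ P.den) = _ ↔ _
  rw [div_eq_iff hP', ← map_mul, (IsFractionRing.injective (PowerSeries κ) _).eq_iff]
  constructor
  · intro hq
    apply mul_left_cancel₀ hP
    rw [← hg, hq]; ring
  · intro hq
    apply mul_right_cancel₀ hden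
    rw [hg, hq]; ring

end

section
variable {K : Type*} [Field K]

/-- The monomial map of an edge, with the second coordinate as parameter. -/
def genericChart {n m : ℕ} (hn : 0 < n) (hm : 0 < m) (a b : ℕ) :
    Ser K →ₐ[K] PowerSeries (RatFunc K) :=
  evalHom (τ := Unit)
    ((PowerSeries.X : PowerSeries (RatFunc K)) ^ n * PowerSeries.C RatFunc.X ^ a)
    ((PowerSeries.X : PowerSeries (RatFunc K)) ^ m * PowerSeries.C RatFunc.X ^ b)
    (by
      change PowerSeries.constantCoeff _ = 0
      simp [hn.ne'])
    (by
      change PowerSeries.constantCoeff _ = 0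
      simp [hm.ne'])

theorem isChart_genericChart {n m a b : ℕ} (hn : 0 < n) (hm : 0 < m) (hab : b * n = a * m + 1) :
    IsChart (genericChart (K := K) hn hm a b) n m a b PowerSeries.X
      (PowerSeries.C RatFunc.X) where
  n_pos := hn
  m_pos := hm
  bezout := hab
  map_x := evalHom_X_zero _ _
  map_y := evalHom_X_one _ _
  ne_zero := PowerSeries.X_ne_zero
  constantCoeff_left := by simp
  constantCoeff_right := by simp [RatFunc.X_ne_zero]

theorem genericChart_order {n m a b : ℕ} (hn : 0 < n) (hm : 0 < m) (hab : b * n = a * m + 1)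
    (f : Ser K) : (genericChart (K := K) hn hm a b f).order = f.weightedOrder ![n, m] := by
  rw [(isChart_genericChart hn hm hab).order_eq, PowerSeries.order_X, mul_one]
  rw [PowerSeries.constantCoeff_C]
  exact RatFunc.transcendental_X

theorem exists_aeval_ratFunc_X (ρ : RatFunc K) : ∃ f g : Polynomial K, g ≠ 0 ∧
    aeval (RatFunc.X : RatFunc K) g * ρ = aeval (RatFunc.X : RatFunc K) f := by
  refine ⟨ρ.num, ρ.denom, ρ.denom_ne_zero, ?_⟩
  rw [RatFunc.aeval_X_left_eq_algebraMap, RatFunc.aeval_X_left_eq_algebraMap]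
  rw [mul_comm, ← eq_div_iff (RatFunc.algebraMap_ne_zero ρ.denom_ne_zero)]
  exact (RatFunc.num_div_denom ρ).symm

variable {B : ℕ → ℕ → ℕ × ℕ} {P : Pencil K} {S : Stage K}

/-- The generic chart of the edge, composed with the pull-back to the stage, realizes `E` over
`K(s)` and sends `y₁` exactly to `s`. -/
theorem isCoordinate_and_eqOn (hB : IsBezoutChoice B) (hS : InProcess B P S) {e : EdgeData}
    (he : IsDicriticalEdge S.pencil e) {E : ValuationSubring (Mer K)}
    (hE : IsDivisorOfEdge S e E) :
    IsCoordinate E (edgeCoord S e) ∧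
      EqOn E P.germ (aeval (edgeCoord S e) (restriction S.pencil e)) := by
  obtain ⟨φ, hφ⟩ := hS.exists_isPull hB
  obtain ⟨-, -, hab⟩ := hB _ _ he.1.n_pos he.1.m_pos he.1.coprime
  set a := (B e.n e.m).1
  set b := (B e.n e.m).2
  let ψ := genericChart (K := K) he.1.n_pos he.1.m_pos a b
  have hC : IsChart ψ e.n e.m a b _ _ := isChart_genericChart he.1.n_pos he.1.m_pos hab
  have hord : ∀ f, (ψ f).order = f.weightedOrder ![e.n, e.m] :=
    genericChart_order he.1.n_pos he.1.m_pos hab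
  let θ := ψ.comp φ
  have hR : Realizes E θ := by
    intro f g hg
    rw [hE f g hg, hφ.pull_eq, ← hord, ← hord]; rfl
  have hψ0 : ∀ f, ψ f = 0 → f = 0 := by
    intro f hf
    rw [← MvPowerSeries.weightedOrder_eq_top_iff (w := ![e.n, e.m]), ← hord, hf,
      PowerSeries.order_zero]
  have hψ : Function.Injective (ψ : Ser K →+* PowerSeries (RatFunc K)) :=
    (injective_iff_map_eq_zero _).2 hψ0
  have hz : HasResidue (fracExt (θ : Ser K →+* PowerSeries (RatFunc K)) hR.injective) (edgeCoord S e) RatFunc.X := by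
    refine ⟨PowerSeries.C RatFunc.X, ?_, PowerSeries.constantCoeff_C _⟩
    have key : ∀ z w, fracExt _ hφ.injective z = w →
        fracExt (θ : Ser K →+* PowerSeries (RatFunc K)) hR.injective z = fracExt _ hψ w :=
      fracExt_comp hφ.injective hψ hR.injective fun _ => rfl
    have hx := key _ _ hφ.map_x
    have hy := key _ _ hφ.map_y
    rw [fracExt_algebraMap] at hx hy
    have hX : (ψ : Ser K →+* PowerSeries (RatFunc K)) (MvPowerSeries.X 0) ≠ 0 := fun h => X_ne_zero 0 (hψ0 _ h)
    have hX' : algebraMap _ (FractionRing (PowerSeries (RatFunc K)))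
      ((ψ : Ser K →+* PowerSeries (RatFunc K)) (MvPowerSeries.X 0)) ≠ 0 :=
      (FaithfulSMul.algebraMap_eq_zero_iff _ _).not.2 hX
    have h₁ : (ψ : Ser K →+* PowerSeries (RatFunc K)) (MvPowerSeries.X 1) ^ e.n =
        PowerSeries.C RatFunc.X *
          (ψ : Ser K →+* PowerSeries (RatFunc K)) (MvPowerSeries.X 0) ^ e.m := by
      change ψ _ ^ _ = _ * ψ _ ^ _
      rw [hC.map_x, hC.map_y, mul_pow, mul_pow, ← pow_mul, ← pow_mul, ← pow_mul, ← pow_mul, hab,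
        mul_comm e.m e.n]
      ring
    have h₂ := congrArg (algebraMap _ (FractionRing (PowerSeries (RatFunc K)))) h₁
    rw [map_mul, map_pow, map_pow] at h₂
    rw [edgeCoord, map_div₀, map_pow, map_pow, hx, hy, div_eq_iff (pow_ne_zero _ hX'), h₂]
  refine ⟨hR.isCoordinate hz RatFunc.transcendental_X exists_aeval_ratFunc_X,
    (hR.eqOn_iff _ _).2 ⟨_, ?_, hz.aeval _⟩⟩
  have hω := he.1.isDicriticalEdge_iff.1 he
  rw [hφ.hasResidue_germ_iff hR.injective (fun _ => rfl)
    (fun h => S.pencil.den_ne_zero (hψ0 _ h))]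
  obtain ⟨q₁, h₁, hq₁⟩ := hC.expansion he.1.weightGE_p
  obtain ⟨q₂, h₂, hq₂⟩ := hC.expansion he.1.weightGE_den
  rw [PowerSeries.constantCoeff_C] at hq₁ hq₂
  -- Both leading forms carry the factor `s ^ (a c)`, which cancels in the residue of the germ.
  rw [he.1.lineForm_p hab, he.2.1, he.2.2, mul_zero, add_zero] at hq₁
  rw [hω, S.pencil.lineForm_den_self he.1.n_pos he.1.m_pos, Polynomial.aeval_monomial] at hq₂
  have hU : algebraMap K (RatFunc K) (MvPowerSeries.constantCoeff S.pencil.U) ≠ 0 := by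
    simpa using S.pencil.constantCoeff_U_ne_zero
  have hX : (RatFunc.X : RatFunc K) ^ (a * S.pencil.c) ≠ 0 := pow_ne_zero _ RatFunc.X_ne_zero
  have hq₂0 : PowerSeries.constantCoeff q₂ ≠ 0 := hq₂ ▸ mul_ne_zero hU hX
  refine ⟨q₁ * q₂⁻¹, ?_, ?_⟩
  · rw [h₁, h₂]
    linear_combination
      (-(PowerSeries.X ^ e.ω * q₁)) * PowerSeries.mul_inv_cancel q₂ hq₂0
  · rw [map_mul, PowerSeries.constantCoeff_inv, hq₁, hq₂, restriction, map_mul, map_mul, map_pow,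
      Polynomial.aeval_X, Polynomial.aeval_C, map_inv₀]
    field_simp

end

/-! ### Orders, and factoring a parametrization through a monomial map -/

section
variable {κ : Type*} [Field κ]

/-- The order of a nonzero power series, as a natural number. -/
def ordNat (f : PowerSeries κ) : ℕ := f.order.toNat

theorem ordNat_mul {f g : PowerSeries κ} (hf : f ≠ 0) (hg : g ≠ 0) :
    ordNat (f * g) = ordNat f + ordNat g := by
  rw [ordNat, PowerSeries.order_mul, ENat.toNat_add]
  · rfl
  · exact fun h => hf (PowerSeries.order_eq_top.1 h)
  · exact fun h => hg (PowerSeries.order_eq_top.1 h)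

theorem ordNat_pow {f : PowerSeries κ} (hf : f ≠ 0) (n : ℕ) : ordNat (f ^ n) = n * ordNat f := by
  induction n with
  | zero => simp [ordNat]
  | succ n ih => rw [pow_succ, ordNat_mul (pow_ne_zero _ hf) hf, ih]; ring

theorem ordNat_eq_zero {f : PowerSeries κ} (hf : PowerSeries.constantCoeff f ≠ 0) :
    ordNat f = 0 := by
  have h := mt PowerSeries.order_ne_zero_iff_constCoeff_eq_zero.1 hf
  rw [not_not] at h
  rw [ordNat, h]; rfl

theorem ordNat_pos {f : PowerSeries κ} (hf : f ≠ 0) (h0 : PowerSeries.constantCoeff f = 0) :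
    0 < ordNat f := by
  rw [Nat.pos_iff_ne_zero, ordNat, ne_eq, ENat.toNat_eq_zero, not_or]
  exact ⟨PowerSeries.order_ne_zero_iff_constCoeff_eq_zero.2 h0,
    fun h => hf (PowerSeries.order_eq_top.1 h)⟩

theorem exists_eq_X_pow_mul {f : PowerSeries κ} (hf : f ≠ 0) :
    ∃ G G' : PowerSeries κ, f = PowerSeries.X ^ ordNat f * G ∧ G * G' = 1 := by
  have hu := (PowerSeries.Unit_of_divided_by_X_pow_order f).isUnit
  rw [PowerSeries.Unit_of_divided_by_X_pow_order_nonzero hf] at hu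
  obtain ⟨G', hG'⟩ := hu.exists_right_inv
  exact ⟨_, G', PowerSeries.X_pow_order_mul_divXPowOrder.symm, hG'⟩

theorem constantCoeff_ne_zero_of_mul_eq_one {G G' : PowerSeries κ} (h : G * G' = 1) :
    PowerSeries.constantCoeff G ≠ 0 := by
  intro h0
  have := congrArg PowerSeries.constantCoeff h
  rw [map_mul, h0, zero_mul, map_one] at this
  exact zero_ne_one this

variable {K : Type*} [Field K] [Algebra K κ]

/-- Every parametrization `(x, y) = (g, h)` factors through a monomial map. -/
theorem exists_isChart {B : ℕ → ℕ → ℕ × ℕ} (hB : IsBezoutChoice B)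
    (θ : Ser K →ₐ[K] PowerSeries κ) (hg : θ (MvPowerSeries.X 0) ≠ 0)
    (hg0 : PowerSeries.constantCoeff (θ (MvPowerSeries.X 0)) = 0)
    (hh : θ (MvPowerSeries.X 1) ≠ 0)
    (hh0 : PowerSeries.constantCoeff (θ (MvPowerSeries.X 1)) = 0) :
    ∃ n m A Z, Nat.Coprime n m ∧ IsChart θ n m (B n m).1 (B n m).2 A Z := by
  have hp := ordNat_pos hg hg0
  have hq := ordNat_pos hh hh0
  obtain ⟨G, G', hG, hGG⟩ := exists_eq_X_pow_mul hg
  obtain ⟨H, H', hH, hHH⟩ := exists_eq_X_pow_mul hh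
  obtain ⟨n, m, hc, hn, hm⟩ :=
    Nat.exists_coprime (ordNat (θ (MvPowerSeries.X 0))) (ordNat (θ (MvPowerSeries.X 1)))
  have hk := Nat.gcd_pos_of_pos_left (ordNat (θ (MvPowerSeries.X 1))) hp
  set k := Nat.gcd (ordNat (θ (MvPowerSeries.X 0))) (ordNat (θ (MvPowerSeries.X 1)))
  have hn0 : 0 < n := Nat.pos_of_ne_zero (by rintro rfl; omega)
  have hm0 : 0 < m := Nat.pos_of_ne_zero (by rintro rfl; omega)
  obtain ⟨-, -, hab⟩ := hB n m hn0 hm0 hc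
  set a := (B n m).1
  set b := (B n m).2
  have hG1 : ∀ l, G ^ l * G' ^ l = 1 := fun l => by rw [← mul_pow, hGG, one_pow]
  have hH1 : ∀ l, H ^ l * H' ^ l = 1 := fun l => by rw [← mul_pow, hHH, one_pow]
  have cG := constantCoeff_ne_zero_of_mul_eq_one hGG
  have cG' := constantCoeff_ne_zero_of_mul_eq_one ((mul_comm _ _).trans hGG)
  have cH := constantCoeff_ne_zero_of_mul_eq_one hHH
  have cH' := constantCoeff_ne_zero_of_mul_eq_one ((mul_comm _ _).trans hHH)
  -- These are `x ^ b y ^ (-a)` and `x ^ (-m) y ^ n` for `x = t ^ (n k) G` and `y = t ^ (m k) H`;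
  -- the powers of `t` are `(b n - a m) k = k` and `0`.
  refine ⟨n, m, PowerSeries.X ^ k * (G ^ b * H' ^ a), H ^ n * G' ^ m, hc, hn0, hm0, hab,
    ?_, ?_, ?_, ?_, ?_⟩
  · conv_lhs => rw [hG, hn]
    have h₁ : (PowerSeries.X ^ k * (G ^ b * H' ^ a)) ^ n * (H ^ n * G' ^ m) ^ a =
        PowerSeries.X ^ (n * k) * G ^ (b * n) * G' ^ (a * m) * (H ^ (a * n) * H' ^ (a * n)) := by
      ring
    rw [h₁, hH1, hab, pow_succ]
    linear_combination (-PowerSeries.X ^ (n * k) * G) * hG1 (a * m)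
  · conv_lhs => rw [hH, hm]
    have h₁ : (PowerSeries.X ^ k * (G ^ b * H' ^ a)) ^ m * (H ^ n * G' ^ m) ^ b =
        PowerSeries.X ^ (m * k) * H ^ (b * n) * H' ^ (a * m) * (G ^ (b * m) * G' ^ (b * m)) := by
      ring
    rw [h₁, hG1, hab, pow_succ]
    linear_combination (-PowerSeries.X ^ (m * k) * H) * hH1 (a * m)
  · refine mul_ne_zero (pow_ne_zero _ PowerSeries.X_ne_zero) (mul_ne_zero (pow_ne_zero _ ?_)
      (pow_ne_zero _ ?_))
    · rintro rfl; simp at cG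
    · rintro rfl; simp at cH'
  · simp [hk.ne']
  · rw [map_mul, map_pow, map_pow]
    exact mul_ne_zero (pow_ne_zero _ cH) (pow_ne_zero _ cG')

end

/-! ### The edge selected by a parametrization -/

section
variable {K : Type*} [Field K]

theorem lineForm_of_unique {n m a b N : ℕ} (hn : 0 < n) (hm : 0 < m) {f : Ser K} {i j : ℕ}
    (hij : n * i + m * j = N)
    (h : ∀ i' j', n * i' + m * j' = N → MvPowerSeries.coeff (expo i' j') f ≠ 0 →
      (i', j') = (i, j)) :
    lineForm n m a b N f =
      Polynomial.monomial (a * i + b * j) (MvPowerSeries.coeff (expo i j) f) := by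
  rw [lineForm, Finset.sum_eq_single (i, j)]
  · rintro ⟨i', j'⟩ hq hne
    rw [mem_linePoints hn hm] at hq
    rw [Polynomial.monomial_eq_zero_iff]
    by_contra h'
    exact hne (h _ _ hq h')
  · intro h
    exact absurd ((mem_linePoints hn hm).2 hij) h

/-- A supporting line with two points of the support contains an edge. -/
theorem exists_isEdge {P : Pencil K} {n m N : ℕ} (hn : 0 < n) (hm : 0 < m)
    (hc : Nat.Coprime n m) (hp : WeightGE n m N P.p) (hd : WeightGE n m N P.den)
    {i j i' j' : ℕ} (h : n * i + m * j = N) (hA : P.A i j ≠ 0) (h' : n * i' + m * j' = N)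
    (hA' : P.A i' j' ≠ 0) (hne : (i, j) ≠ (i', j')) :
    ∃ e : EdgeData, e.n = n ∧ e.m = m ∧ e.ω = N ∧ IsEdge P e := by
  classical
  let F := (linePoints n m N).filter fun q => P.A q.1 q.2 ≠ 0
  have hF : ∀ q : ℕ × ℕ, q ∈ F ↔ n * q.1 + m * q.2 = N ∧ P.A q.1 q.2 ≠ 0 := by
    intro q
    simp only [F, Finset.mem_filter, mem_linePoints hn hm]
  have hmem : (i, j) ∈ F := (hF _).2 ⟨h, hA⟩
  have hmem' : (i', j') ∈ F := (hF _).2 ⟨h', hA'⟩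
  -- The ends of the edge are the points of the support on the line with extreme abscissas;
  -- coprimality makes their difference a multiple of `(m, -n)`.
  obtain ⟨⟨i₁, j₁⟩, h₁, hmax⟩ := F.exists_max_image Prod.fst ⟨_, hmem⟩
  obtain ⟨⟨i₂, j₂⟩, h₂, hmin⟩ := F.exists_min_image Prod.fst ⟨_, hmem⟩
  rw [hF] at h₁ h₂
  obtain ⟨l₁, hA₁⟩ := h₁
  obtain ⟨l₂, hA₂⟩ := h₂
  simp only at l₁ l₂ hA₁ hA₂ hmax hmin
  have hlt : i₂ < i₁ := by
    by_contra hle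
    have e₁ := hmax _ hmem
    have e₂ := hmax _ hmem'
    have e₃ := hmin _ hmem
    have e₄ := hmin _ hmem'
    simp only at e₁ e₂ e₃ e₄
    have hi : i = i' := by omega
    subst hi
    have hj : j = j' := Nat.eq_of_mul_eq_mul_left hm (by omega)
    exact hne (by rw [hj])
  have hj : ∀ x y, n * x + m * y = N → x ≤ i₁ → j₁ ≤ y := by
    intro x y hxy hx
    have := Nat.mul_le_mul_left n hx
    exact Nat.le_of_mul_le_mul_left (by omega : m * j₁ ≤ m * y) hm
  obtain ⟨I, rfl⟩ := Nat.exists_eq_add_of_le hlt.le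
  obtain ⟨J, rfl⟩ := Nat.exists_eq_add_of_le (hj _ _ l₂ hlt.le)
  have hIJ : n * I = m * J := by
    rw [mul_add] at l₁ l₂; omega
  obtain ⟨d, rfl⟩ : m ∣ I := hc.symm.dvd_of_dvd_mul_left ⟨J, hIJ⟩
  have hJ : J = n * d := by
    refine Nat.eq_of_mul_eq_mul_left hm ?_
    rw [← hIJ]; ring
  subst hJ
  have hω : n * i₂ + m * j₁ + n * m * d = N := by rw [← l₁]; ring
  refine ⟨⟨n, m, i₂, j₁, d⟩, rfl, rfl, hω, hn, hm, ?_, hc, hA₁, hA₂, ?_, ?_⟩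
  · refine Nat.pos_of_ne_zero ?_
    rintro rfl
    simp at hlt
  · intro x y hxy
    by_contra hlt
    simp only [EdgeData.ω, hω, not_le] at hlt
    exact hxy ((P.A_eq_zero_iff _ _).2 ⟨hp _ _ hlt, hd _ _ hlt⟩)
  · intro x y hxy hl
    simp only [EdgeData.ω, hω] at hl
    have hm : (x, y) ∈ F := (hF _).2 ⟨hl, hxy⟩
    exact ⟨hmin _ hm, hj _ _ hl (hmax _ hm)⟩

variable {κ : Type*} [Field κ] [Algebra K κ]

theorem exists_algebraMap_eq [IsAlgClosed K] {ζ : κ} (h : ¬ Transcendental K ζ) :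
    ∃ α, algebraMap K κ α = ζ := by
  rw [Transcendental, not_not] at h
  have hi := h.isIntegral
  have := IsAlgClosed.degree_eq_one_of_irreducible K (minpoly.irreducible hi)
  exact minpoly.mem_range_of_degree_eq_one K ζ this

/-- A parametrization along which the germ is not constant either determines a dicritical edge
or passes through a point of the divisor of an edge which is not dicritical. -/
theorem IsChart.exists_edge [IsAlgClosed K] {P : Pencil K} {ψ : Ser K →ₐ[K] PowerSeries κ}
    {n m a b : ℕ} {A Z : PowerSeries κ} (hC : IsChart ψ n m a b A Z) (hc : Nat.Coprime n m)
    {q : PowerSeries κ} (hq : ψ P.p = q * ψ P.den)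
    (hρ : ∀ t : K, algebraMap K κ t ≠ PowerSeries.constantCoeff q) :
    ∃ e : EdgeData, e.n = n ∧ e.m = m ∧ IsEdge P e ∧
      (IsDicriticalEdge P e ∧ Transcendental K (PowerSeries.constantCoeff Z) ∨
        e.ω < n * P.c ∧ ∃ α : K, algebraMap K κ α = PowerSeries.constantCoeff Z ∧
          (edgePoly P e).eval (Polynomial.C α) = 0) := by
  have hn := hC.n_pos
  have hm := hC.m_pos
  have hζ := hC.constantCoeff_right
  obtain ⟨N, -, hw, i₀, j₀, hij, hc0⟩ := exists_weight (n := n) (m := m)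
    (f := P.p) (fun h => P.not_dvd (h ▸ dvd_zero _))
  rcases lt_or_ge N (n * P.c) with hlt | hge
  · obtain ⟨q₁, h₁, hq₁⟩ := hC.expansion hw
    obtain ⟨q₂, h₂, -⟩ := hC.expansion (P.weightGE_den (m := m) (le_refl (n * P.c)))
    obtain ⟨l, hl⟩ := Nat.exists_eq_add_of_lt hlt
    -- The denominator has order larger by a positive power of `A`, so regularity of the germ kills
    -- the leading form of `p` at the residue of `Z`.
    have hq₁' : q₁ = q * (A ^ (l + 1) * q₂) := by
      apply mul_left_cancel₀ (pow_ne_zero N hC.ne_zero)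
      rw [← h₁, hq, h₂, hl]; ring
    rw [hq₁', map_mul, map_mul, map_pow, hC.constantCoeff_left, zero_pow (Nat.succ_ne_zero l),
      zero_mul, mul_zero, eq_comm] at hq₁
    have hne := lineForm_ne_zero (a := a) (b := b) hn hm hC.bezout hij hc0
    obtain ⟨α, hα⟩ := exists_algebraMap_eq
      (fun h => hne (transcendental_iff.1 h _ hq₁) : ¬ Transcendental K
        (PowerSeries.constantCoeff Z))
    have hα0 : α ≠ 0 := by
      rintro rfl
      rw [map_zero] at hα
      exact hζ hα.symm
    rw [← hα, Polynomial.aeval_algebraMap_apply, FaithfulSMul.algebraMap_eq_zero_iff,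
      Polynomial.coe_aeval_eq_eval] at hq₁
    -- A single monomial does not vanish at `α ≠ 0`, so the line contains a second point of the
    -- support.
    obtain ⟨i', j', h', hc', hne'⟩ : ∃ i' j', n * i' + m * j' = N ∧
        MvPowerSeries.coeff (expo i' j') P.p ≠ 0 ∧ (i', j') ≠ (i₀, j₀) := by
      by_contra hcon
      push Not at hcon
      rw [lineForm_of_unique hn hm hij hcon, Polynomial.eval_monomial] at hq₁
      exact mul_ne_zero hc0 (pow_ne_zero _ hα0) hq₁
    obtain ⟨e, rfl, rfl, rfl, he⟩ := exists_isEdge hn hm hc hw (P.weightGE_den hlt.le) hij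
      (fun h => hc0 ((P.A_eq_zero_iff _ _).1 h).1) h'
      (fun h => hc' ((P.A_eq_zero_iff _ _).1 h).1) hne'.symm
    refine ⟨e, rfl, rfl, he, Or.inr ⟨hlt, α, hα, ?_⟩⟩
    rw [he.lineForm_p hC.bezout, Polynomial.eval_mul, Polynomial.eval_pow, Polynomial.eval_X,
      mul_eq_zero, or_iff_right (pow_ne_zero _ hα0)] at hq₁
    rw [edgePoly_eq, edgePart_den_of_lt hlt, Polynomial.map_zero, mul_zero, sub_zero,
      Polynomial.eval_map, Polynomial.eval₂_at_apply, hq₁, map_zero]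
  · have hwp : WeightGE n m (n * P.c) P.p := fun i j h => hw i j (h.trans_le hge)
    have hwd : WeightGE n m (n * P.c) P.den := P.weightGE_den le_rfl
    obtain ⟨q₁, h₁, hq₁⟩ := hC.expansion hwp
    obtain ⟨q₂, h₂, hq₂⟩ := hC.expansion hwd
    have hq₁' : q₁ = q * q₂ := by
      apply mul_left_cancel₀ (pow_ne_zero (n * P.c) hC.ne_zero)
      rw [← h₁, hq, h₂]; ring
    rw [P.lineForm_den_self hn hm, Polynomial.aeval_monomial] at hq₂
    rw [hq₁', map_mul, hq₂] at hq₁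
    have hU : algebraMap K κ (MvPowerSeries.constantCoeff P.U) ≠ 0 :=
      (FaithfulSMul.algebraMap_eq_zero_iff _ _).not.2 P.constantCoeff_U_ne_zero
    -- If `p` had at most the monomial `(c, 0)` on the line, the residue of the germ would be the
    -- constant `p_{c0} / U(0, 0)`.
    obtain ⟨i', j', h', hc', hne'⟩ : ∃ i' j', n * i' + m * j' = n * P.c ∧
        MvPowerSeries.coeff (expo i' j') P.p ≠ 0 ∧ (i', j') ≠ (P.c, 0) := by
      by_contra hcon
      push Not at hcon
      rw [lineForm_of_unique hn hm (by simp) hcon, Polynomial.aeval_monomial, mul_zero,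
        add_zero, ← mul_assoc] at hq₁
      have h₃ := mul_right_cancel₀ (pow_ne_zero _ hζ) hq₁
      refine hρ (MvPowerSeries.coeff (expo P.c 0) P.p / MvPowerSeries.constantCoeff P.U) ?_
      rw [map_div₀, ← h₃, mul_div_cancel_right₀ _ hU]
    obtain ⟨e, rfl, rfl, hω, he⟩ := exists_isEdge hn hm hc hwp hwd (i := P.c) (j := 0)
      (by simp) (P.A_self_ne_zero) h'
      (fun h => hc' ((P.A_eq_zero_iff _ _).1 h).1) hne'.symm
    refine ⟨e, rfl, rfl, he, Or.inl ⟨he.isDicriticalEdge_iff.2 hω, ?_⟩⟩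
    -- With the residue of `Z` in `K`, the residue of the germ would be a value in `K` of a quotient
    -- of leading forms.
    by_contra htr
    obtain ⟨α, hα⟩ := exists_algebraMap_eq htr
    rw [← hα] at hq₁ hζ
    rw [Polynomial.aeval_algebraMap_apply, Polynomial.coe_aeval_eq_eval, ← map_pow, ← map_mul]
      at hq₁
    refine hρ ((lineForm e.n e.m a b (e.n * P.c) P.p).eval α /
      (MvPowerSeries.constantCoeff P.U * α ^ (a * P.c))) ?_
    rw [map_div₀, ← hq₁, mul_div_cancel_right₀]
    rw [map_mul, map_pow]
    exact mul_ne_zero hU (pow_ne_zero _ hζ)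

end

/-! ### Steps along a parametrization and termination -/

section
variable {K : Type*} [Field K] {B : ℕ → ℕ → ℕ × ℕ}

/-- As `ω < n c`, the left end of the edge belongs to `p`, so after division by `x₁ ^ ω` the
numerator is prime to `x₁`. The denominator keeps `x₁ ^ (n c - ω)`, and `y' + α` is a unit. -/
theorem exists_isStrictTransform (hB : IsBezoutChoice B) {P : Pencil K} {e : EdgeData}
    (he : IsEdge P e) (hω : e.ω < e.n * P.c) {α : K} (hα : α ≠ 0) :
    ∃ Q : Pencil K, IsStrictTransform B P e α Q ∧ Q.c = e.n * P.c - e.ω := by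
  obtain ⟨-, -, hab⟩ := hB _ _ he.n_pos he.m_pos he.coprime
  have hline := e.line (le_refl e.d)
  rw [Nat.sub_self, mul_zero, add_zero] at hline
  have hcoeff : MvPowerSeries.coeff (expo e.u (e.v + e.n * e.d)) P.p ≠ 0 := fun h =>
    he.left_mem ((P.A_eq_zero_iff _ _).2
      ⟨h, P.coeff_den_of_lt_weight (n := e.n) (m := e.m) (hline ▸ hω)⟩)
  obtain ⟨g, hg, hdvd⟩ := toricHom_eq he.n_pos he.m_pos α hab he.weightGE_p hline hcoeff
  obtain ⟨Y', hY'⟩ := (isUnit_X_add_C hα).exists_right_inv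
  have hY'u : IsUnit Y' := IsUnit.of_mul_eq_one _ ((mul_comm _ _).trans hY')
  set s := {w' | ∃ i j, P.A i j ≠ 0 ∧ w' = (B e.n e.m).1 * i + (B e.n e.m).2 * j}
  -- The point `(c, 0)` gives `w ≤ a c`, so the power of `y' + α` left in the new unit has exponent
  -- `l = a c - w ≥ 0`.
  have hs : (B e.n e.m).1 * P.c ∈ s := ⟨P.c, 0, P.A_self_ne_zero, by simp⟩
  have hleast : IsLeast s (sInf s) := ⟨Nat.sInf_mem ⟨_, hs⟩, fun _ h => Nat.sInf_le h⟩
  obtain ⟨w, hw⟩ : ∃ w, w = sInf s := ⟨_, rfl⟩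
  rw [← hw] at hleast
  obtain ⟨l, hl⟩ := Nat.exists_eq_add_of_le (hleast.2 hs)
  have hX : (MvPowerSeries.X 0 : Ser K) ^ (e.n * P.c) =
      MvPowerSeries.X 0 ^ e.ω * MvPowerSeries.X 0 ^ (e.n * P.c - e.ω) := by
    rw [← pow_add, Nat.add_sub_cancel' hω.le]
  have hY1 : (MvPowerSeries.X 1 + MvPowerSeries.C α) ^ w * Y' ^ w = 1 := by
    rw [← mul_pow, hY', one_pow]
  refine ⟨⟨Y' ^ w * g, e.n * P.c - e.ω,
    (MvPowerSeries.X 1 + MvPowerSeries.C α) ^ l *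
      toricHom he.n_pos he.m_pos (B e.n e.m).1 (B e.n e.m).2 α P.U, by omega,
      ((isUnit_X_add_C hα).pow _).mul (P.isUnit_U.map _), ?_⟩, ⟨w, hleast, ?_, ?_⟩, rfl⟩
  · rwa [(hY'u.pow w).dvd_mul_left]
  · rw [toricNewton_eq he.n_pos he.m_pos, hg]
    linear_combination (MvPowerSeries.X 0 ^ e.ω * g) * hY1
  · rw [toricNewton_eq he.n_pos he.m_pos, Pencil.den, Pencil.den, map_mul, map_pow,
      toricHom_X_zero, mul_pow, ← pow_mul, ← pow_mul, hX, hl, pow_add]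
    ring

/-- The pencil in the coordinates `(x, y')`, where `y = y' + α * x ^ m`. -/
def Pencil.translate (P : Pencil K) {m : ℕ} (hm : 0 < m) (α : K) : Pencil K where
  p := translationHom hm α P.p
  c := P.c
  U := translationHom hm α P.U
  c_pos := P.c_pos
  isUnit_U := P.isUnit_U.map _
  not_dvd := by
    intro h
    have := map_dvd (translationHom hm (-α)) h
    rw [translationHom_X_zero, translationHom_neg] at this
    exact P.not_dvd this

theorem Pencil.translate_den (P : Pencil K) {m : ℕ} (hm : 0 < m) (α : K) :
    (P.translate hm α).den = translationHom hm α P.den := by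
  rw [Pencil.den, Pencil.den, map_mul, map_pow, translationHom_X_zero]; rfl

variable {κ : Type*} [Field κ] [Algebra K κ]

/-- A nonzero series at a stage which comes from `L` does not vanish along a parametrization. -/
theorem IsPull.map_ne_zero {P : Pencil K} {S : Stage K} {φ : Ser K →ₐ[K] Ser K}
    (hφ : IsPull P S φ) {θ ψ : Ser K →ₐ[K] PowerSeries κ}
    (hθ : Function.Injective (θ : Ser K →+* PowerSeries κ)) (hψ : ∀ f, ψ (φ f) = θ f)
    {z : Mer K} {f : Ser K}
    (hz : fracExt (φ : Ser K →+* Ser K) hφ.injective z = algebraMap (Ser K) (Mer K) f)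
    (hf : f ≠ 0) : ψ f ≠ 0 := by
  obtain ⟨F, G, hG, rfl⟩ := IsFractionRing.div_surjective (A := Ser K) z
  have hG0 : G ≠ 0 := nonZeroDivisors.ne_zero hG
  have hφ0 : ∀ h, φ h = 0 → h = 0 := (injective_iff_map_eq_zero _).1 hφ.injective
  have hφG : algebraMap (Ser K) (Mer K) (φ G) ≠ 0 :=
    (FaithfulSMul.algebraMap_eq_zero_iff _ _).not.2 fun h => hG0 (hφ0 _ h)
  have h₁ : φ F = f * φ G := by
    apply IsFractionRing.injective (Ser K) (Mer K)
    rw [map_mul, ← hz, ← div_eq_iff hφG]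
    erw [map_div₀, fracExt_algebraMap, fracExt_algebraMap]
    rfl
  intro h
  have h₂ := congrArg ψ h₁
  rw [map_mul, h, zero_mul, hψ] at h₂
  have hF : F = 0 := (injective_iff_map_eq_zero _).1 hθ _ h₂
  rw [hF, map_zero, eq_comm, mul_eq_zero] at h₁
  exact h₁.elim hf fun h => hG0 (hφ0 _ h)

/-- The pull-back by the parametrization `(x, y) = (g, h)` of a curve. -/
def powerEval (g h : PowerSeries κ) (hg : PowerSeries.constantCoeff g = 0)
    (hh : PowerSeries.constantCoeff h = 0) : Ser K →ₐ[K] PowerSeries κ :=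
  evalHom (τ := Unit) g h hg hh

section powerEval

variable {g h g' h' : PowerSeries κ} (hg : PowerSeries.constantCoeff g = 0)
  (hh : PowerSeries.constantCoeff h = 0)

theorem powerEval_X_zero : powerEval g h hg hh (MvPowerSeries.X 0 : Ser K) = g :=
  evalHom_X_zero _ _

theorem powerEval_X_one : powerEval g h hg hh (MvPowerSeries.X 1 : Ser K) = h :=
  evalHom_X_one _ _

theorem powerEval_congr (hg' : PowerSeries.constantCoeff g' = 0)
    (hh' : PowerSeries.constantCoeff h' = 0) (h₁ : g = g') (h₂ : h = h') :
    (powerEval g h hg hh : Ser K →ₐ[K] PowerSeries κ) = powerEval g' h' hg' hh' := by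
  subst h₁ h₂; rfl

theorem powerEval_evalHom {u v : Ser K}
    (hu : MvPowerSeries.constantCoeff u = 0) (hv : MvPowerSeries.constantCoeff v = 0)
    (hg' : PowerSeries.constantCoeff g' = 0) (hh' : PowerSeries.constantCoeff h' = 0)
    (h₁ : powerEval g h hg hh u = g') (h₂ : powerEval g h hg hh v = h') (f : Ser K) :
    powerEval g h hg hh (evalHom u v hu hv f) = powerEval g' h' hg' hh' f :=
  evalHom_evalHom _ _ _ _ _ _ h₁ h₂ f

end powerEval

/-- The parametrization of the valuation passes through the origin of the coordinates of the
stage. -/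
structure IsCentered (S : Stage K) (θ ψ : Ser K →ₐ[K] PowerSeries κ) : Prop where
  comp_pull : ∀ f, ψ (S.pull f) = θ f
  left : PowerSeries.constantCoeff (ψ (MvPowerSeries.X 0)) = 0
  right : PowerSeries.constantCoeff (ψ (MvPowerSeries.X 1)) = 0
  isEval : ψ = powerEval (ψ (MvPowerSeries.X 0)) (ψ (MvPowerSeries.X 1)) left right

theorem isCentered_evalHom {S : Stage K} {θ : Ser K →ₐ[K] PowerSeries κ} {g h : PowerSeries κ}
    (hg : PowerSeries.constantCoeff g = 0) (hh : PowerSeries.constantCoeff h = 0)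
    (hc : ∀ f, powerEval g h hg hh (S.pull f) = θ f) :
    IsCentered S θ (powerEval g h hg hh) where
  comp_pull := hc
  left := by rw [powerEval_X_zero, hg]
  right := by rw [powerEval_X_one, hh]
  isEval := powerEval_congr _ _ _ _ (powerEval_X_zero _ _).symm (powerEval_X_one _ _).symm

variable {P : Pencil K} {S : Stage K} {θ ψ : Ser K →ₐ[K] PowerSeries κ}

theorem IsCentered.comp_evalHom (h : IsCentered S θ ψ) {u v : Ser K}
    (hu : MvPowerSeries.constantCoeff u = 0) (hv : MvPowerSeries.constantCoeff v = 0)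
    {g g' : PowerSeries κ} (hg : PowerSeries.constantCoeff g = 0)
    (hg' : PowerSeries.constantCoeff g' = 0)
    (h₁ : powerEval g g' hg hg' u = ψ (MvPowerSeries.X 0))
    (h₂ : powerEval g g' hg hg' v = ψ (MvPowerSeries.X 1)) (f : Ser K) :
    powerEval g g' hg hg' (evalHom u v hu hv f) = ψ f := by
  rw [h.isEval]
  exact powerEval_evalHom _ _ _ _ _ _ h₁ h₂ f

/-- One step of the process, along a parametrization, when the edge is not dicritical. -/
theorem IsCentered.exists_step (hB : IsBezoutChoice B) (h : IsCentered S θ ψ) {e : EdgeData}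
    (he : IsEdge S.pencil e) (hω : e.ω < e.n * S.pencil.c) {A Z : PowerSeries κ}
    (hC : IsChart ψ e.n e.m (B e.n e.m).1 (B e.n e.m).2 A Z) {α : K}
    (hα : algebraMap K κ α = PowerSeries.constantCoeff Z)
    (hroot : (edgePoly S.pencil e).eval (Polynomial.C α) = 0) :
    ∃ (S' : Stage K) (ψ' : Ser K →ₐ[K] PowerSeries κ), Step B S S' ∧ IsCentered S' θ ψ' ∧
      (ψ' (MvPowerSeries.X 0) = A ∧ S'.pencil.c = e.n * S.pencil.c - e.ω ∨
        e.n = 1 ∧ e.u = 0 ∧ e.v = 0 ∧ ψ' (MvPowerSeries.X 0) = ψ (MvPowerSeries.X 0) ∧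
          S'.pencil.c = S.pencil.c ∧ ∃ W : PowerSeries κ,
            PowerSeries.constantCoeff W = 0 ∧
              ψ' (MvPowerSeries.X 1) = ψ (MvPowerSeries.X 1) * W) := by
  have hα0 : α ≠ 0 := by
    rintro rfl
    exact edgePoly_eval_zero_ne he hroot
  have hcZ : PowerSeries.constantCoeff (Z - algebraMap K (PowerSeries κ) α) = 0 := by
    rw [map_sub, ← hα]
    exact sub_self _
  by_cases hpow : ∃ a, IsPowerEdge S.pencil e a
  · obtain ⟨α', hpow⟩ := hpow
    obtain ⟨hn1, hu0, hv0, β, hβ⟩ := id hpow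
    -- The only root of `β (s - α') ^ d` is `α'`, so the translation of the process is the one that
    -- the parametrization requires.
    have hαα : α = α' := by
      have hβ0 : β ≠ 0 := by
        rintro rfl
        apply edgePoly_eval_zero_ne he
        rw [hβ]; simp
      rw [hβ, Polynomial.eval_mul, Polynomial.eval_C, Polynomial.eval_pow, Polynomial.eval_sub,
        Polynomial.eval_X, Polynomial.eval_C, mul_eq_zero, or_iff_right (by simpa using hβ0)]
        at hroot
      exact Polynomial.C_injective (sub_eq_zero.1 ((pow_eq_zero_iff he.d_pos.ne').1 hroot))
    subst hαα
    obtain ⟨Z', hZ'⟩ : ∃ Z', Z * Z' = 1 :=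
      ⟨Z⁻¹, PowerSeries.mul_inv_cancel Z hC.constantCoeff_right⟩
    have hab := hC.bezout
    have hx := hC.map_x
    have hy := hC.map_y
    rw [hn1] at hx hab
    rw [hn1] at hy
    set a := (B 1 e.m).1
    set b := (B 1 e.m).2
    rw [mul_one] at hab
    let h' : PowerSeries κ := ψ (MvPowerSeries.X 1) -
      algebraMap K (PowerSeries κ) α * ψ (MvPowerSeries.X 0) ^ e.m
    -- For `n = 1` one has `b = a m + 1`, so `y = x ^ m Z` and `y - α x ^ m = y Z⁻¹ (Z - α)`: the
    -- order of `y` strictly increases.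
    have hh' : h' = ψ (MvPowerSeries.X 1) * (Z' * (Z - algebraMap K (PowerSeries κ) α)) := by
      simp only [h', hx, hy, hab]
      linear_combination (-A ^ e.m * Z ^ (a * e.m) * (Z - algebraMap K (PowerSeries κ) α)) * hZ'
    have hc' : PowerSeries.constantCoeff h' = 0 := by rw [hh', map_mul, h.right, zero_mul]
    refine ⟨⟨S.pencil.translate he.m_pos α, translation e.m α ∘ S.pull, S.x,
      S.y - algebraMap K (Mer K) α * S.x ^ e.m⟩, powerEval _ h' h.left hc',
      Step.translate _ _ e α he hpow ?_ ?_ rfl rfl rfl, isCentered_evalHom _ _ ?_,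
      Or.inr ⟨hn1, hu0, hv0, powerEval_X_zero _ _, rfl,
        Z' * (Z - algebraMap K (PowerSeries κ) α), ?_, ?_⟩⟩
    · rw [translation_eq he.m_pos]; rfl
    · rw [translation_eq he.m_pos]; exact Pencil.translate_den _ _ _
    · intro f
      rw [← h.comp_pull f]
      change powerEval _ _ _ _ (translation _ _ (S.pull f)) = _
      rw [translation_eq he.m_pos]
      refine h.comp_evalHom _ _ _ _ (powerEval_X_zero _ _) ?_ _
      rw [map_add, map_mul, map_pow, powerEval_X_zero, powerEval_X_one, algHom_C]
      simp only [h']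
      exact sub_add_cancel _ _
    · rw [map_mul, hcZ, mul_zero]
    · rw [powerEval_X_one, hh']
  · obtain ⟨Q, hQ, hQc⟩ := exists_isStrictTransform hB he hω hα0
    refine ⟨⟨Q, toricNewton e.n e.m (B e.n e.m).1 (B e.n e.m).2 α ∘ S.pull,
      S.x ^ (B e.n e.m).2 / S.y ^ (B e.n e.m).1,
      S.y ^ e.n / S.x ^ e.m - algebraMap K (Mer K) α⟩,
      powerEval A (Z - algebraMap K (PowerSeries κ) α) hC.constantCoeff_left hcZ,
      Step.toric _ _ e α he (fun hd => hω.ne (he.isDicriticalEdge_iff.1 hd))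
        (fun a ha => hpow ⟨a, ha⟩) hroot hQ rfl rfl rfl, isCentered_evalHom _ _ ?_,
      Or.inl ⟨powerEval_X_zero _ _, hQc⟩⟩
    intro f
    rw [← h.comp_pull f]
    change powerEval _ _ _ _ (toricNewton _ _ _ _ _ (S.pull f)) = _
    rw [toricNewton_eq he.n_pos he.m_pos]
    have hZ : powerEval A (Z - algebraMap K (PowerSeries κ) α) hC.constantCoeff_left hcZ
        (MvPowerSeries.X 1 + MvPowerSeries.C α : Ser K) = Z := by
      rw [map_add, powerEval_X_one, algHom_C]
      exact sub_add_cancel _ _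
    refine h.comp_evalHom _ _ _ _ ?_ ?_ _
    · rw [map_mul, map_pow, map_pow, hZ, powerEval_X_zero, hC.map_x]
    · rw [map_mul, map_pow, map_pow, hZ, powerEval_X_zero, hC.map_y]

/-- Following a parametrization along which the germ is not constant, the process reaches a
dicritical edge whose divisor is that of the parametrization. -/
theorem IsCentered.exists_dicritical [IsAlgClosed K] (hB : IsBezoutChoice B)
    (hθ : Function.Injective (θ : Ser K →+* PowerSeries κ)) {ρ : κ}
    (hgerm : HasResidue (fracExt (θ : Ser K →+* PowerSeries κ) hθ) P.germ ρ)
    (hρ : ∀ t : K, algebraMap K κ t ≠ ρ) (D M : ℕ) (hS : InProcess B P S)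
    (h : IsCentered S θ ψ) (hD : S.pencil.c * ordNat (ψ (MvPowerSeries.X 0)) = D)
    (hM : D - ordNat (ψ (MvPowerSeries.X 1)) = M) :
    ∃ (S' : Stage K) (e : EdgeData), InProcess B P S' ∧ IsDicriticalEdge S'.pencil e ∧
      ∃ k : ℕ∞, k ≠ 0 ∧ k ≠ ⊤ ∧
        ∀ f, (θ f).order = (S'.pull f).weightedOrder ![e.n, e.m] * k := by
  -- Lexicographic descent on `D = c · ord x` and `M = D - ord y`: toric steps lower `D`,
  -- translations keep `D` and lower `M`.
  induction D using Nat.strong_induction_on generalizing M S ψ with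
  | _ D ihD =>
  induction M using Nat.strong_induction_on generalizing S ψ with
  | _ M ihM =>
  obtain ⟨φ, hφ⟩ := hS.exists_isPull hB
  have hcomp : ∀ f, ψ (φ f) = θ f := by
    intro f
    rw [← h.comp_pull f, hφ.pull_eq]
  have hx0 := hφ.map_ne_zero hθ hcomp hφ.map_x (X_ne_zero 0)
  have hy0 := hφ.map_ne_zero hθ hcomp hφ.map_y (X_ne_zero 1)
  obtain ⟨n, m, A, Z, hc, hC⟩ := exists_isChart hB ψ hx0 h.left hy0 h.right
  have hZ0 : Z ≠ 0 := by
    rintro rfl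
    exact hC.constantCoeff_right (map_zero _)
  have hden : ψ S.pencil.den ≠ 0 := by
    rw [Pencil.den, map_mul, map_pow]
    exact mul_ne_zero (pow_ne_zero _ hx0) (S.pencil.isUnit_U.map ψ).ne_zero
  obtain ⟨q, hq, rfl⟩ := (hφ.hasResidue_germ_iff hθ hcomp hden ρ).1 hgerm
  obtain ⟨e, rfl, rfl, he, ⟨hd, htr⟩ | ⟨hω, α, hα, hroot⟩⟩ := hC.exists_edge hc hq hρ
  · refine ⟨S, e, hS, hd, A.order, PowerSeries.order_ne_zero_iff_constCoeff_eq_zero.2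
      hC.constantCoeff_left, fun h => hC.ne_zero (PowerSeries.order_eq_top.1 h), fun f => ?_⟩
    rw [← hC.order_eq htr, h.comp_pull]
  · have hk := ordNat_pos hC.ne_zero hC.constantCoeff_left
    have hox : ordNat (ψ (MvPowerSeries.X 0)) = e.n * ordNat A := by
      rw [hC.map_x, ordNat_mul (pow_ne_zero _ hC.ne_zero) (pow_ne_zero _ hZ0), ordNat_pow hC.ne_zero,
        ordNat_pow hZ0, ordNat_eq_zero hC.constantCoeff_right, mul_zero, add_zero]
    have hoy : ordNat (ψ (MvPowerSeries.X 1)) = e.m * ordNat A := by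
      rw [hC.map_y, ordNat_mul (pow_ne_zero _ hC.ne_zero) (pow_ne_zero _ hZ0), ordNat_pow hC.ne_zero,
        ordNat_pow hZ0, ordNat_eq_zero hC.constantCoeff_right, mul_zero, add_zero]
    have hnmd := Nat.mul_pos (Nat.mul_pos he.n_pos he.m_pos) he.d_pos
    obtain ⟨S', ψ', hs, hS', ⟨hx', hc'⟩ | ⟨hn1, hu0, hv0, hx', hc', W, hW, hy'⟩⟩ :=
      h.exists_step hB he hω hC hα hroot
    · refine ihD _ ?_ _ (hS.tail hs) hS' rfl rfl
      -- The new value of `D` is `(n c - ω) ord A`, the old one `n c · ord A`, and `ω ≥ n m d > 0`.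
      rw [hx', hc', ← hD, hox, mul_left_comm, ← mul_assoc]
      refine Nat.mul_lt_mul_of_pos_right ?_ hk
      rw [EdgeData.ω] at hω ⊢
      omega
    · have hlt : D - ordNat (ψ' (MvPowerSeries.X 1)) < M := by
        obtain ⟨φ', hφ'⟩ := InProcess.exists_isPull hB (hS.tail hs)
        have hy0' := hφ'.map_ne_zero hθ (fun f => by rw [← hS'.comp_pull f, hφ'.pull_eq])
          hφ'.map_y (X_ne_zero 1)
        rw [hy'] at hy0' ⊢
        have hW0 := right_ne_zero_of_mul hy0'
        have hWpos := ordNat_pos hW0 hW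
        rw [ordNat_mul hy0 hW0, ← hM, hoy]
        -- Here `ω = m d < c`, hence `ord y = m · ord A < D`; so the truncated difference `M` is
        -- positive and really decreases.
        have hmc : e.m < S.pencil.c := by
          simp only [EdgeData.ω, hu0, hv0, hn1, mul_zero, one_mul, zero_add] at hω
          have := Nat.le_mul_of_pos_right e.m he.d_pos
          omega
        have hDlt : e.m * ordNat A < D := by
          rw [← hD, hox, hn1, one_mul]
          exact Nat.mul_lt_mul_of_pos_right hmc hk
        omega
      exact ihM _ hlt (hS.tail hs) hS' (by rw [hx', hc', hD]) rfl

/-! ### From blow-ups to parametrizations -/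

theorem constantCoeff_evalHom {τ R : Type*} [CommRing R] [Algebra K R] {g h : MvPowerSeries τ R}
    (hg : MvPowerSeries.constantCoeff g = 0) (hh : MvPowerSeries.constantCoeff h = 0) {u : Ser K}
    (hu : MvPowerSeries.constantCoeff u = 0) :
    MvPowerSeries.constantCoeff (evalHom g h hg hh u) = 0 := by
  rw [evalHom_apply]
  refine MvPowerSeries.constantCoeff_subst_eq_zero (hasSubst_cons hg hh) ?_ hu
  intro s
  fin_cases s
  · exact hg
  · exact hh

/-- This is all that the argument uses about blow-ups: their composite pull-back substitutes two
series without constant term. -/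
theorem IsBlowUpPull.exists_eq_evalHom {σ : Ser K → Ser K} (h : IsBlowUpPull σ) :
    ∃ (u v : Ser K) (hu : MvPowerSeries.constantCoeff u = 0)
      (hv : MvPowerSeries.constantCoeff v = 0), σ = evalHom u v hu hv := by
  have comp : ∀ (g g' u v : Ser K) (hg : MvPowerSeries.constantCoeff g = 0)
      (hg' : MvPowerSeries.constantCoeff g' = 0) (hu : MvPowerSeries.constantCoeff u = 0)
      (hv : MvPowerSeries.constantCoeff v = 0),
      ∃ (u' v' : Ser K) (hu' : MvPowerSeries.constantCoeff u' = 0)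
        (hv' : MvPowerSeries.constantCoeff v' = 0),
        substPair g g' ∘ (evalHom u v hu hv : Ser K →ₐ[K] Ser K) = evalHom u' v' hu' hv' := by
    intro g g' u v hg hg' hu hv
    refine ⟨_, _, constantCoeff_evalHom hg hg' hu, constantCoeff_evalHom hg hg' hv, ?_⟩
    funext f
    rw [Function.comp_apply, substPair_eq_evalHom hg hg']
    exact evalHom_evalHom _ _ _ _ _ _ rfl rfl f
  induction h with
  | origin => exact ⟨_, _, MvPowerSeries.constantCoeff_X _, MvPowerSeries.constantCoeff_X _,
      funext fun f => (evalHom_X_X f).symm⟩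
  | finite σ t _ ih =>
    obtain ⟨u, v, hu, hv, rfl⟩ := ih
    exact comp _ _ _ _ (MvPowerSeries.constantCoeff_X 0) (by simp) hu hv
  | infinite σ _ ih =>
    obtain ⟨u, v, hu, hv, rfl⟩ := ih
    exact comp _ _ _ _ (by simp) (MvPowerSeries.constantCoeff_X 1) hu hv

theorem weightedOrder_one_one (f : Ser K) : f.weightedOrder ![1, 1] = f.order := by
  rw [MvPowerSeries.order]
  congr 1
  funext s; fin_cases s <;> rfl

theorem exists_dicritical_stage [IsAlgClosed K] (hB : IsBezoutChoice B) {P : Pencil K}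
    {E : ValuationSubring (Mer K)} (hE : IsDicritical P E) :
    ∃ (S : Stage K) (e : EdgeData), InProcess B P S ∧ IsDicriticalEdge S.pencil e ∧
      IsDivisorOfEdge S e E := by
  obtain ⟨⟨σ, hσ, hEσ⟩, hmem, hne⟩ := hE
  obtain ⟨u, v, hu, hv, rfl⟩ := hσ.exists_eq_evalHom
  -- The generic line `(x, y) = (t, t s)`, along which the order in `t` is the order of a series at
  -- the point. Here `a = 0` is allowed, since a chart needs only `b n = a m + 1`.
  let χ := genericChart (K := K) one_pos one_pos 0 1
  have hχ : ∀ w : Ser K, MvPowerSeries.constantCoeff w = 0 →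
      PowerSeries.constantCoeff (χ w) = 0 := fun w hw => constantCoeff_evalHom _ _ hw
  let θ := χ.comp (evalHom u v hu hv)
  have hR : Realizes E θ := by
    intro f g hg
    rw [hEσ f g hg, ← weightedOrder_one_one, ← weightedOrder_one_one,
      ← genericChart_order one_pos one_pos (a := 0) (b := 1) rfl,
      ← genericChart_order one_pos one_pos (a := 0) (b := 1) rfl]
    rfl
  obtain ⟨ρ, hρ⟩ := (hR.mem_iff _).1 hmem
  have hρK : ∀ t : K, algebraMap K (RatFunc K) t ≠ ρ := by
    rintro t rfl
    exact hne t ((hR.eqOn_iff _ _).2 ⟨_, hρ, hasResidue_algebraMap θ hR.injective t⟩)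
  have hθ : θ = powerEval (χ u) (χ v) (hχ u hu) (hχ v hv) := by
    ext1 f
    exact evalHom_evalHom _ _ hu hv _ _ rfl rfl f
  have hC : IsCentered (Stage.init P) θ (powerEval (χ u) (χ v) (hχ u hu) (hχ v hv)) :=
    isCentered_evalHom _ _ fun f => by rw [hθ]; rfl
  obtain ⟨S, e, hS, hd, k, hk0, hkt, hk⟩ := hC.exists_dicritical hB hR.injective hρ hρK _ _
    Relation.ReflTransGen.refl rfl rfl
  refine ⟨S, e, hS, hd, fun f g hg => ?_⟩
  -- The order along the parametrization is the weighted order times a finite nonzero factor, so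
  -- both define the same valuation ring.
  rw [hR f g hg, hk, hk, ENat.mul_le_mul_right_iff hk0 hkt]

end

end SpecialPencil

end

theorem mainTheorem5 {K : Type*} [Field K] [IsAlgClosed K]
    (B : ℕ → ℕ → ℕ × ℕ) (hB : SpecialPencil.IsBezoutChoice B)
    (P : SpecialPencil.Pencil K)
    (E : ValuationSubring (SpecialPencil.Mer K)) (hE : SpecialPencil.IsDicritical P E) :
    (∃ z : SpecialPencil.Mer K, SpecialPencil.IsCoordinate E z ∧
      ∃ q : Polynomial K, SpecialPencil.EqOn E P.germ (aeval z q)) ∧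
    (∃ (S : SpecialPencil.Stage K) (e : SpecialPencil.EdgeData),
      SpecialPencil.InProcess B P S ∧ SpecialPencil.IsDicriticalEdge S.pencil e ∧
      SpecialPencil.IsDivisorOfEdge S e E) ∧
    (∀ (S : SpecialPencil.Stage K) (e : SpecialPencil.EdgeData),
      SpecialPencil.InProcess B P S → SpecialPencil.IsDicriticalEdge S.pencil e →
      SpecialPencil.IsDivisorOfEdge S e E →
      SpecialPencil.IsCoordinate E (SpecialPencil.edgeCoord S e) ∧
      ∃ q : Polynomial K,
        SpecialPencil.edgePoly S.pencil e =
          Polynomial.C (Polynomial.C (MvPowerSeries.constantCoeff S.pencil.U)) *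
            (q.map Polynomial.C - Polynomial.C Polynomial.X) ∧
        q.natDegree = e.d ∧
        SpecialPencil.EqOn E P.germ (aeval (SpecialPencil.edgeCoord S e) q)) := by
  have part₃ : ∀ (S : SpecialPencil.Stage K) (e : SpecialPencil.EdgeData),
      SpecialPencil.InProcess B P S → SpecialPencil.IsDicriticalEdge S.pencil e →
      SpecialPencil.IsDivisorOfEdge S e E →
      SpecialPencil.IsCoordinate E (SpecialPencil.edgeCoord S e) ∧
      SpecialPencil.EqOn E P.germ
        (aeval (SpecialPencil.edgeCoord S e) (SpecialPencil.restriction S.pencil e)) :=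
    fun _ _ hS he hdiv => SpecialPencil.isCoordinate_and_eqOn hB hS he hdiv
  -- The edge found for the second claim also supplies, through the third, the coordinate and the
  -- polynomial of the first.
  obtain ⟨S, e, hS, he, hdiv⟩ := SpecialPencil.exists_dicritical_stage hB hE
  obtain ⟨hz, hq⟩ := part₃ S e hS he hdiv
  refine ⟨⟨_, hz, _, hq⟩, ⟨S, e, hS, he, hdiv⟩, fun S' e' hS' he' hdiv' => ?_⟩
  obtain ⟨hz', hq'⟩ := part₃ S' e' hS' he' hdiv'
  exact ⟨hz', _, he'.edgePoly_eq, he'.natDegree_restriction, hq'⟩
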